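/- Consider a finite bipartite graph $G$ with a left part, a right part, and $e$ edges. An $\alpha$-graceful labeling of $G$ assigns to each vertex a label from $\{0,1,\ldots,e\}$ so that every label in the left part is strictly smaller than every label in the right part and so that, when every edge is labeled with the difference between the labels of its endpoints, the edge labels are $1,2,\ldots,e$, each occurring exactly once. Two such labelings are considered essentially the same when an automorphism of $G$ transforms one into the other. Let $\mathcal{A}(a,b)$ be the number of essentially distinct $\alpha$-graceful labelings of the complete bipartite graph $K_{a,b}$ with $a$ vertices in the left part and $b$ vertices in the right part. Theorem. Let $n$ be a nonnegative integer, let $p_1 \neq p_2$ be primes and let $q_1 \neq q_2$ be primes (the sets $\{p_1,p_2\}$ and $\{q_1,q_2\}$ need not be disjoint), and let $a = p_1^n p_2^n$ and $b = q_1^n q_2^n$. Then \[\mathcal{A}(a,b) = \sum_{i=0}^{2n} (-1)^{n+i}\binom{2n}{i}^4 = (-1)^n\left[\binom{2n}{0}^4 - \binom{2n}{1}^4 + \binom{2n}{2}^4 - \cdots + \binom{2n}{2n}^4\right].\] Moreover, $\mathcal{A}(a,b)$ equals the number of ordered pairs $(S',S'')$ of subsets of $\{0,1,\ldots,ab\}$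 with $|S'| = a$, $|S''| = b$ and $S''-S' = \{y-x \mid x \in S',\ y \in S''\} = \{1,2,\ldots,ab\}$. -/

import Mathlib

/-- The label that a vertex labeling `f` induces on an edge: the (absolute) difference between the
labels of its two endpoints. -/
def edgeLabel {V : Type*} (f : V → ℕ) : Sym2 V → ℕ :=
  Sym2.lift ⟨fun u v => ((f u : ℤ) - (f v : ℤ)).natAbs, fun u v => by dsimp only; omega⟩

/-- `f` is an α-graceful labeling of the finite bipartite graph `G` with left part `L` and right
part `R`: with `e` the number of edges of `G`, the vertex labels lie in `{0, 1, …, e}`, every label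
in the left part is strictly smaller than every label in the right part, and the labels on the
edges are `1, 2, …, e`, each one occurring exactly once. -/
structure IsAlphaGraceful {V : Type*} (G : SimpleGraph V) (L R : Set V) (f : V → ℕ) : Prop where
  le_edges : ∀ v, f v ≤ G.edgeSet.ncard
  left_lt_right : ∀ u ∈ L, ∀ v ∈ R, f u < f v
  bijOn_edges : Set.BijOn (edgeLabel f) G.edgeSet (Set.Icc 1 G.edgeSet.ncard)

/-- Two α-graceful labelings of `G` are essentially the same when an automorphism of `G` transforms
one into the other. -/
def alphaGracefulSetoid {V : Type*} (G : SimpleGraph V) (L R : Set V) :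
    Setoid {f : V → ℕ // IsAlphaGraceful G L R f} where
  r f g := ∃ φ : G ≃g G, ∀ v, g.1 v = f.1 (φ v)
  iseqv :=
    { refl := fun _ => ⟨RelIso.refl _, fun _ => rfl⟩
      symm := by
        rintro f g ⟨φ, h⟩
        exact ⟨φ.symm, fun v => by rw [h, RelIso.apply_symm_apply]⟩
      trans := by
        rintro f g k ⟨φ, h⟩ ⟨ψ, h'⟩
        exact ⟨ψ.trans φ, fun v => by rw [h', h]; rfl⟩ }

/-- The number `𝒜(a, b)` of essentially distinct α-graceful labelings of `K_{a,b}`, whose left part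
has `a` vertices and whose right part has `b` vertices. -/
noncomputable def numAlphaGraceful (a b : ℕ) : ℕ :=
  Nat.card (Quotient (alphaGracefulSetoid (completeBipartiteGraph (Fin a) (Fin b))
    (Set.range Sum.inl) (Set.range Sum.inr)))

/-- The ordered pairs `(S', S'')` of subsets of `{0, 1, …, ab}` with `|S'| = a`, `|S''| = b` and
`S'' - S' = {1, 2, …, ab}`, the differences being taken in `ℤ`. -/
def differencePairs (a b : ℕ) : Set (Finset ℕ × Finset ℕ) :=
  {S | S.1 ⊆ Finset.Icc 0 (a * b) ∧ S.2 ⊆ Finset.Icc 0 (a * b) ∧ S.1.card = a ∧ S.2.card = b ∧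
    {z : ℤ | ∃ x ∈ S.1, ∃ y ∈ S.2, z = (y : ℤ) - (x : ℤ)} = Set.Icc 1 ((a : ℤ) * (b : ℤ))}

/-! Since automorphisms permute the vertices within each part, a labeling of `K_{a,b}` amounts to
its two label sets, that is, to a pair in `differencePairs a b`. Reflecting the lower set in its
maximum and shifting the upper set down turns differences into sums, so such pairs correspond to
tilings `A + B = {0, …, ab - 1}` with `|A| = a` and `|B| = b` (`ncard_differencePairs`).

A tiling has a rigid block structure: if `1 ∈ A` and `m` is the length of the initial run of `A`,
then `A` consists of full blocks of length `m` and `B` of multiples of `m` (`block_structure`).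
Dividing by `m` gives a smaller tiling in which `1` has left the first factor. Iterating with the
roles exchanged encodes a tiling by interleaved ordered factorizations of `a` and `b`. With `P_t = ζ
* (ζ - 1) ^ t` (Dirichlet product), the recursion solves to the count `∑ t, P_t(a) * P_t(b)`
(`card_intervalTilings`).

The binomial theorem for `ζ = 1 + (ζ - 1)` shows that the binomial transform of `k ↦ P_k(a)` at `x`
is `ζ ^ (x + 1)` evaluated at `a`, which is `(n + x).choose n ^ 2` for `a = p₁ ^ n * p₂ ^ n`.
Inverting this for `b` and applying it directly for `a` leaves a single sum over `m`. This sum and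
the alternating sum of fourth powers both reduce to the same positive sum of products of binomial
coefficients (`sum_neg_one_pow_choose_mul_choose_sq`, `sum_neg_one_pow_choose_pow_four`). -/

/-! ### Binomial identities and the alternating sum of fourth powers -/

/-- The `n`-th forward difference of a binomial coefficient, as an alternating sum. -/
theorem sum_neg_one_pow_mul_choose_add (n y j : ℕ) :
    ∑ m ∈ Finset.range (n + 1), (-1 : ℤ) ^ (n - m) * (n.choose m) * ((y + m).choose (n + j)) =
      y.choose j := by
  have h := fwdDiff_iter_eq_sum_shift (1 : ℕ) (fun x ↦ (x.choose (n + j) : ℤ)) n y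
  rw [fwdDiff_iter_choose] at h
  simpa using h.symm

theorem choose_mul_choose_add_add (x n m : ℕ) :
    (x + n + m).choose (n + m) * (n + m).choose n = (x + n).choose n * (x + n + m).choose m := by
  have e1 : (x + n + m).choose (n + m) = (n + m + x).choose (n + m) := by congr 1; ring
  have e2 : (x + n).choose n = (n + x).choose n := by congr 1; ring
  have e3 : (x + n + m).choose m = (m + (n + x)).choose m := by congr 1; ring
  have e4 : n + m + x = m + (n + x) := by ring
  rw [e1, e2, e3]
  have : (((n + m + x).choose (n + m) * (n + m).choose n : ℕ) : ℚ) =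
      (((n + x).choose n * (m + (n + x)).choose m : ℕ) : ℚ) := by
    push_cast [Nat.cast_add_choose]
    rw [e4]
    have := fun k : ℕ ↦ (Nat.cast_ne_zero (R := ℚ)).2 (Nat.factorial_ne_zero k)
    field_simp [this]
  exact_mod_cast this

/-- The expansion of the square of a binomial coefficient as a combination of binomial
coefficients. -/
theorem choose_sq_eq_sum (n x : ℕ) :
    ((n + x).choose n : ℤ) ^ 2 = ∑ m ∈ Finset.range (n + 1),
      (-1 : ℤ) ^ (n - m) * ((n + m).choose n * n.choose m) * (x + (n + m)).choose (n + m) := by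
  have h := sum_neg_one_pow_mul_choose_add n (x + n) x
  have e : (x + n).choose x = (x + n).choose n := Nat.choose_symm_add
  rw [e] at h
  rw [add_comm n x, sq]
  nth_rw 1 [← h]
  rw [Finset.sum_mul]
  refine Finset.sum_congr rfl fun m _ ↦ ?_
  have h1 := choose_mul_choose_add_add x n m
  have e2 : (x + n + m).choose (n + x) = (x + n + m).choose m := by
    rw [add_comm n x, ← Nat.choose_symm_add]
  rw [e2, ← add_assoc]
  zify at h1
  linear_combination (-1) ^ (n - m) * (n.choose m : ℤ) * (-h1)

/-- Vandermonde expands `(2 * n + m).choose n` over `i`, and `n.choose m * m.choose i = n.choose i *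
(n - i).choose (m - i)`. The remaining sum over `m` is an `(n - i)`-th forward difference of `y ↦
y.choose (2 * n)` at `2 * n + i`, hence a single binomial coefficient. -/
theorem sum_neg_one_pow_choose_mul_choose_mul_choose (n : ℕ) :
    ∑ m ∈ Finset.range (n + 1),
      (-1 : ℤ) ^ (n - m) * n.choose m * ((2 * n + m).choose n * (2 * n + m).choose (2 * n)) =
    ∑ i ∈ Finset.range (n + 1), (n.choose i : ℤ) * (2 * n).choose (n - i) *
      (2 * n + i).choose n := by
  have key : ∀ m ∈ Finset.range (n + 1),
      (-1 : ℤ) ^ (n - m) * n.choose m * ((2 * n + m).choose n * (2 * n + m).choose (2 * n)) =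
      ∑ i ∈ Finset.range (n + 1), (n.choose i : ℤ) * (2 * n).choose (n - i) *
        (if i ≤ m then (-1 : ℤ) ^ (n - m) * (n - i).choose (m - i) *
          (2 * n + m).choose (2 * n) else 0) := by
    intro m hm
    have hv : ((2 * n + m).choose n : ℤ) =
        ∑ i ∈ Finset.range (n + 1), (m.choose i : ℤ) * (2 * n).choose (n - i) := by
      rw [add_comm, Nat.add_choose_eq, Finset.Nat.sum_antidiagonal_eq_sum_range_succ_mk]
      push_cast
      rfl
    rw [hv, Finset.sum_mul, Finset.mul_sum]
    refine Finset.sum_congr rfl fun i _ ↦ ?_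
    split_ifs with him
    · have h := Nat.choose_mul (n := n) him
      zify at h
      linear_combination (-1) ^ (n - m) * ((2 * n).choose (n - i) : ℤ) *
        (2 * n + m).choose (2 * n) * h
    · rw [Nat.choose_eq_zero_of_lt (by omega : m < i)]
      simp
  rw [Finset.sum_congr rfl key, Finset.sum_comm]
  refine Finset.sum_congr rfl fun i hi ↦ ?_
  rw [← Finset.mul_sum]
  congr 1
  have hi' := Finset.mem_range_succ_iff.1 hi
  obtain ⟨d, rfl⟩ := Nat.exists_eq_add_of_le hi'
  rw [← Finset.sum_range_add_sum_Ico _ (by omega : i ≤ i + d + 1),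
    Finset.sum_eq_zero (fun m hm ↦ if_neg (by simpa using hm)), zero_add,
    Finset.sum_Ico_eq_sum_range, show i + d + 1 - i = d + 1 by omega]
  have h := sum_neg_one_pow_mul_choose_add d (2 * (i + d) + i) (2 * i + d)
  have e : (2 * (i + d) + i).choose (2 * i + d) = (2 * (i + d) + i).choose (i + d) := by
    rw [show 2 * (i + d) + i = (2 * i + d) + (i + d) by ring]
    exact Nat.choose_symm_add
  rw [← e, ← h]
  refine Finset.sum_congr rfl fun m _ ↦ ?_
  rw [if_pos (by omega), show i + d - (i + m) = d - m by omega, show i + d - i = d by omega,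
    show i + m - i = m by omega, show 2 * (i + d) + (i + m) = 2 * (i + d) + i + m by ring,
    show d + (2 * i + d) = 2 * (i + d) by ring]

/-- The central coefficient comes out through `(n + m).choose n * (2 * n + m).choose n = (2 *
n).choose n * (2 * n + m).choose (2 * n)`. -/
theorem sum_neg_one_pow_choose_mul_choose_sq (n : ℕ) :
    ∑ m ∈ Finset.range (n + 1), (-1 : ℤ) ^ (n - m) * ((n + m).choose n * n.choose m) *
      ((2 * n + m).choose n : ℤ) ^ 2 =
    (2 * n).choose n * ∑ i ∈ Finset.range (n + 1), (n.choose i : ℤ) * (2 * n).choose (n - i) *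
      (2 * n + i).choose n := by
  rw [← sum_neg_one_pow_choose_mul_choose_mul_choose, Finset.mul_sum]
  refine Finset.sum_congr rfl fun m _ ↦ ?_
  have h := choose_mul_choose_add_add m n n
  have e1 : (m + n + n).choose (n + n) = (2 * n + m).choose (2 * n) := by congr 1 <;> ring
  have e2 : (m + n).choose n = (n + m).choose n := by congr 1; ring
  have e3 : (m + n + n).choose n = (2 * n + m).choose n := by congr 1; ring
  rw [e1, e2, e3, ← two_mul] at h
  zify at h
  linear_combination (-1) ^ (n - m) * (n.choose m : ℤ) * (2 * n + m).choose n * (-h)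

/-- The coefficient of `X ^ (2 * j)` in `(1 - X) ^ L * (1 + X) ^ L`. -/
theorem sum_neg_one_pow_choose_mul_choose (L j : ℕ) :
    ∑ u ∈ Finset.range (2 * j + 1), (-1 : ℤ) ^ u * (L.choose u * L.choose (2 * j - u)) =
      (-1) ^ j * L.choose j := by
  open Polynomial in
  have hneg : ∀ u, ((1 - X : ℤ[X]) ^ L).coeff u = (-1) ^ u * L.choose u := by
    intro u
    have : (1 - X : ℤ[X]) ^ L = ((1 + X : ℤ[X]) ^ L).comp (C (-1) * X) := by
      simp [sub_eq_add_neg]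
    rw [this, comp_C_mul_X_coeff, coeff_one_add_X_pow, mul_comm]
  have h1 : ((1 - X : ℤ[X]) ^ L * (1 + X) ^ L).coeff (2 * j) =
      ∑ u ∈ Finset.range (2 * j + 1), (-1 : ℤ) ^ u * (L.choose u * L.choose (2 * j - u)) := by
    rw [coeff_mul, Finset.Nat.sum_antidiagonal_eq_sum_range_succ_mk]
    refine Finset.sum_congr rfl fun u _ ↦ ?_
    rw [hneg, coeff_one_add_X_pow, mul_assoc]
  have h2 : (1 - X : ℤ[X]) ^ L * (1 + X) ^ L = expand ℤ 2 ((1 - X) ^ L) := by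
    rw [← mul_pow]
    simp only [map_pow, map_sub, map_one, expand_X]
    ring
  rw [← h1, h2, mul_comm 2 j, coeff_expand_mul two_pos, hneg]

/-- The square of a binomial coefficient `N.choose i` as a sum over the size `r` of the
intersection of an `i`-subset and an `(N - i)`-subset. -/
theorem choose_sq_eq_sum_two_mul (n i : ℕ) (hi : i ≤ 2 * n) :
    ((2 * n).choose i) ^ 2 = ∑ r ∈ Finset.range (n + 1), (2 * n).choose (2 * r) *
      (2 * r).choose r * (if r ≤ i then (2 * n - 2 * r).choose (i - r) else 0) := by
  -- When all parts are nonnegative, both sides are the multinomial coefficient `(2n)! / (r! r! (i -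
  -- r)! (2n - i - r)!)`; otherwise both vanish.
  have hterm : ∀ r ≤ n, (2 * n).choose i * (i.choose r * (2 * n - i).choose r) =
      (2 * n).choose (2 * r) * (2 * r).choose r *
        (if r ≤ i then (2 * n - 2 * r).choose (i - r) else 0) := by
    intro r hrn
    split_ifs with hr
    · by_cases hr2 : r ≤ 2 * n - i
      · obtain ⟨s, rfl⟩ := Nat.exists_eq_add_of_le hr
        obtain ⟨t, ht⟩ := Nat.exists_eq_add_of_le hr2
        have hN : 2 * n = (r + s) + (r + t) := by omega
        rw [ht, Nat.add_sub_cancel_left, hN,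
          show r + s + (r + t) - 2 * r = s + t by omega]
        have e : (r + s + (r + t)).choose (2 * r) = (2 * r + (s + t)).choose (2 * r) := by
          congr 1; ring
        have e' : (2 * r).choose r = (r + r).choose r := by congr 1; ring
        rw [e, e', ← Nat.cast_inj (R := ℚ)]
        push_cast [Nat.cast_add_choose]
        rw [show r + s + (r + t) = 2 * r + (s + t) by ring, ← two_mul]
        have := fun k : ℕ ↦ (Nat.cast_ne_zero (R := ℚ)).2 (Nat.factorial_ne_zero k)
        field_simp [this]
      · rw [Nat.choose_eq_zero_of_lt (by omega : 2 * n - i < r),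
          Nat.choose_eq_zero_of_lt (by omega : 2 * n - 2 * r < i - r)]
        simp
    · rw [Nat.choose_eq_zero_of_lt (by omega : i < r)]
      simp
  have hv : (2 * n).choose i =
      ∑ r ∈ Finset.range (2 * n - i + 1), i.choose r * (2 * n - i).choose r := by
    have h := Nat.add_choose_eq i (2 * n - i) (2 * n - i)
    rw [Nat.add_sub_cancel' hi, Nat.choose_symm hi,
      Finset.Nat.sum_antidiagonal_eq_sum_range_succ_mk] at h
    rw [h]
    refine Finset.sum_congr rfl fun r hr ↦ ?_
    rw [Nat.choose_symm (Finset.mem_range_succ_iff.1 hr)]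
  have hext : ∑ r ∈ Finset.range (2 * n - i + 1), i.choose r * (2 * n - i).choose r =
      ∑ r ∈ Finset.range (n + 1), i.choose r * (2 * n - i).choose r := by
    have hz : ∀ r, (n < r ∨ 2 * n - i < r) → i.choose r * (2 * n - i).choose r = 0 := by
      intro r hr
      by_cases h : i < r
      · rw [Nat.choose_eq_zero_of_lt h, zero_mul]
      · rw [Nat.choose_eq_zero_of_lt (by omega : 2 * n - i < r), mul_zero]
    trans ∑ r ∈ Finset.range (2 * n + 1), i.choose r * (2 * n - i).choose r
    · refine Finset.sum_subset (Finset.range_subset_range.2 (by omega)) fun r _ hr ↦ hz r ?_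
      simp only [Finset.mem_range] at hr; omega
    · refine (Finset.sum_subset (Finset.range_subset_range.2 (by omega)) fun r _ hr ↦ hz r ?_).symm
      simp only [Finset.mem_range] at hr; omega
  rw [sq]
  nth_rw 2 [hv]
  rw [hext, Finset.mul_sum]
  exact Finset.sum_congr rfl fun r hr ↦ hterm r (Finset.mem_range_succ_iff.1 hr)

/-- Put `j = n - r`, `l = n - s` and `u = i - r`. Regrouping factorials turns the product of the two
binomials into a constant times `(j + l).choose u * (j + l).choose (2 * j - u)`, so the alternating
sum is a coefficient of `(1 - X ^ 2) ^ (j + l)`. -/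
theorem sum_neg_one_pow_choose_sub_mul_choose_sub (n r s : ℕ) (hr : r ≤ n) (hs : s ≤ n) :
    ∑ i ∈ Finset.range (2 * n + 1), (-1 : ℚ) ^ i *
      ((if r ≤ i then ((2 * n - 2 * r).choose (i - r) : ℚ) else 0) *
        (if s ≤ i then ((2 * n - 2 * s).choose (i - s) : ℚ) else 0)) =
    (-1) ^ n * (((2 * (n - r)).factorial : ℚ) * (2 * (n - s)).factorial /
      (((n - r) + (n - s)).factorial * (n - r).factorial * (n - s).factorial)) := by
  obtain ⟨j, rfl⟩ := Nat.exists_eq_add_of_le hr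
  obtain ⟨l, hl⟩ := Nat.exists_eq_add_of_le hs
  have hne := fun k : ℕ ↦ (Nat.cast_ne_zero (R := ℚ)).2 (Nat.factorial_ne_zero k)
  rw [show r + j - r = j by omega, show r + j - s = l by omega,
    show 2 * (r + j) - 2 * r = 2 * j by omega, show 2 * (r + j) - 2 * s = 2 * l by omega]
  have hsub : ∑ i ∈ Finset.range (2 * (r + j) + 1), (-1 : ℚ) ^ i *
      ((if r ≤ i then ((2 * j).choose (i - r) : ℚ) else 0) *
        (if s ≤ i then ((2 * l).choose (i - s) : ℚ) else 0)) =
      ∑ i ∈ Finset.Ico r (r + (2 * j + 1)), (-1 : ℚ) ^ i *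
      ((if r ≤ i then ((2 * j).choose (i - r) : ℚ) else 0) *
        (if s ≤ i then ((2 * l).choose (i - s) : ℚ) else 0)) := by
    refine (Finset.sum_subset (fun i hi ↦ ?_) fun i _ hi ↦ ?_).symm
    · simp only [Finset.mem_Ico, Finset.mem_range] at hi ⊢; omega
    · simp only [Finset.mem_Ico, not_and, not_lt] at hi
      split_ifs with h1
      · rw [Nat.choose_eq_zero_of_lt (by have := hi h1; omega : 2 * j < i - r)]; simp
      all_goals simp
  have hterm : ∀ u ∈ Finset.range (2 * j + 1), (-1 : ℚ) ^ (r + u) *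
      ((if r ≤ r + u then ((2 * j).choose (r + u - r) : ℚ) else 0) *
        (if s ≤ r + u then ((2 * l).choose (r + u - s) : ℚ) else 0)) =
      (-1) ^ r * ((2 * j).factorial * (2 * l).factorial / ((j + l).factorial : ℚ) ^ 2) *
        ((-1) ^ u * ((j + l).choose u * (j + l).choose (2 * j - u))) := by
    intro u hu
    have hu := Finset.mem_range_succ_iff.1 hu
    rw [if_pos (by omega), Nat.add_sub_cancel_left]
    split_ifs with h1
    · by_cases h2 : u ≤ j + l
      · rw [Nat.cast_choose ℚ hu, Nat.cast_choose ℚ h2,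
          Nat.cast_choose ℚ (by omega : r + u - s ≤ 2 * l),
          Nat.cast_choose ℚ (by omega : 2 * j - u ≤ j + l),
          show 2 * l - (r + u - s) = j + l - u by omega,
          show r + u - s = j + l - (2 * j - u) by omega]
        field_simp [hne]
        ring
      · rw [Nat.choose_eq_zero_of_lt (by omega : j + l < u),
          Nat.choose_eq_zero_of_lt (by omega : 2 * l < r + u - s)]
        simp
    · rw [Nat.choose_eq_zero_of_lt (by omega : j + l < 2 * j - u)]
      simp
  have hmain : ∑ u ∈ Finset.range (2 * j + 1), (-1 : ℚ) ^ u *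
      ((j + l).choose u * (j + l).choose (2 * j - u)) = (-1) ^ j * (j + l).choose j := by
    exact_mod_cast sum_neg_one_pow_choose_mul_choose (j + l) j
  rw [hsub, Finset.sum_Ico_eq_sum_range, Nat.add_sub_cancel_left, Finset.sum_congr rfl hterm,
    ← Finset.mul_sum, hmain, Nat.cast_add_choose, pow_add]
  field_simp [hne]

/-- The alternating sum of the fourth powers of the binomial coefficients `(2 * n).choose i`. -/
theorem sum_neg_one_pow_choose_pow_four (n : ℕ) :
    ∑ i ∈ Finset.range (2 * n + 1), (-1 : ℤ) ^ (n + i) * ((2 * n).choose i : ℤ) ^ 4 =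
    (2 * n).choose n * ∑ i ∈ Finset.range (n + 1), (n.choose i : ℤ) * (2 * n).choose (n - i) *
      (2 * n + i).choose n := by
  have hne := fun k : ℕ ↦ (Nat.cast_ne_zero (R := ℚ)).2 (Nat.factorial_ne_zero k)
  let g : ℕ → ℕ → ℚ := fun r i ↦ if r ≤ i then ((2 * n - 2 * r).choose (i - r) : ℚ) else 0
  let W : ℕ → ℚ := fun r ↦ (2 * n).choose (2 * r) * (2 * r).choose r
  have hW : ∀ r ≤ n, W r = (2 * n).factorial / ((2 * (n - r)).factorial * r.factorial ^ 2) := by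
    intro r hr
    simp only [W]
    rw [Nat.cast_choose ℚ (by omega : 2 * r ≤ 2 * n), Nat.cast_choose ℚ (by omega : r ≤ 2 * r),
      show 2 * r - r = r by omega, show 2 * n - 2 * r = 2 * (n - r) by omega]
    field_simp [hne]
  have hsq : ∀ i ≤ 2 * n, ((2 * n).choose i : ℚ) ^ 2 =
      ∑ r ∈ Finset.range (n + 1), W r * g r i := by
    intro i hi
    have h := congrArg (Nat.cast (R := ℚ)) (choose_sq_eq_sum_two_mul n i hi)
    push_cast at h
    exact h
  -- Vandermonde for `(n + (n - r)) + n`, divided by `n! * (n + (n - r))!`.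
  have hvan : ∀ r ≤ n, ∑ s ∈ Finset.range (n + 1),
      (1 / (s.factorial ^ 2 * ((n - r) + (n - s)).factorial * (n - s).factorial) : ℚ) =
      (2 * n + (n - r)).choose n / (n.factorial * (n + (n - r)).factorial) := by
    intro r hr
    have h : ((2 * n + (n - r)).choose n : ℚ) = ∑ s ∈ Finset.range (n + 1),
        (((n + (n - r)).choose s * n.choose (n - s) : ℕ) : ℚ) := by
      rw [show 2 * n + (n - r) = n + (n - r) + n by ring, Nat.add_choose_eq,
        Finset.Nat.sum_antidiagonal_eq_sum_range_succ_mk]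
      push_cast; rfl
    rw [h, Finset.sum_div]
    refine Finset.sum_congr rfl fun s hs ↦ ?_
    have hs := Finset.mem_range_succ_iff.1 hs
    push_cast
    rw [Nat.cast_choose ℚ (by omega : s ≤ n + (n - r)), Nat.cast_choose ℚ (by omega : n - s ≤ n),
      show n - (n - s) = s by omega, show n + (n - r) - s = n - r + (n - s) by omega]
    field_simp [hne]
  have hfin : (∑ i ∈ Finset.range (2 * n + 1), (-1 : ℚ) ^ i * ((2 * n).choose i : ℚ) ^ 4) =
      (-1) ^ n * ((2 * n).choose n * ∑ i ∈ Finset.range (n + 1), (n.choose i : ℚ) *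
        (2 * n).choose (n - i) * (2 * n + i).choose n) := by
    calc ∑ i ∈ Finset.range (2 * n + 1), (-1 : ℚ) ^ i * ((2 * n).choose i : ℚ) ^ 4
      _ = ∑ i ∈ Finset.range (2 * n + 1), ∑ r ∈ Finset.range (n + 1),
          ∑ s ∈ Finset.range (n + 1), W r * W s * ((-1 : ℚ) ^ i * (g r i * g s i)) := by
        refine Finset.sum_congr rfl fun i hi ↦ ?_
        have hi := Finset.mem_range_succ_iff.1 hi
        rw [show ((2 * n).choose i : ℚ) ^ 4 =
          ((2 * n).choose i : ℚ) ^ 2 * ((2 * n).choose i : ℚ) ^ 2 by ring, hsq i hi,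
          Finset.sum_mul_sum, Finset.mul_sum]
        refine Finset.sum_congr rfl fun r _ ↦ ?_
        rw [Finset.mul_sum]
        refine Finset.sum_congr rfl fun s _ ↦ ?_
        ring
      _ = ∑ r ∈ Finset.range (n + 1), ∑ s ∈ Finset.range (n + 1), W r * W s *
          ∑ i ∈ Finset.range (2 * n + 1), (-1 : ℚ) ^ i * (g r i * g s i) := by
        rw [Finset.sum_comm]
        refine Finset.sum_congr rfl fun r _ ↦ ?_
        rw [Finset.sum_comm]
        simp only [Finset.mul_sum]
      -- The factorials `(2(n - r))!` and `(2(n - s))!` in the alternating sum over `i` cancel the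
      -- denominators of `W r` and `W s`.
      _ = ∑ r ∈ Finset.range (n + 1), (-1) ^ n * ((2 * n).factorial ^ 2 /
          (r.factorial ^ 2 * (n - r).factorial) * ∑ s ∈ Finset.range (n + 1),
          (1 / (s.factorial ^ 2 * ((n - r) + (n - s)).factorial * (n - s).factorial) : ℚ)) := by
        refine Finset.sum_congr rfl fun r hr ↦ ?_
        have hr := Finset.mem_range_succ_iff.1 hr
        rw [Finset.mul_sum, Finset.mul_sum]
        refine Finset.sum_congr rfl fun s hs ↦ ?_
        have hs := Finset.mem_range_succ_iff.1 hs
        rw [sum_neg_one_pow_choose_sub_mul_choose_sub n r s hr hs, hW r hr, hW s hs]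
        field_simp [hne]
      _ = _ := by
        rw [← Finset.mul_sum]
        congr 1
        rw [← Finset.sum_range_reflect, Finset.mul_sum]
        refine Finset.sum_congr rfl fun i hi ↦ ?_
        have hi := Finset.mem_range_succ_iff.1 hi
        rw [show n + 1 - 1 - i = n - i by omega, hvan (n - i) (by omega),
          show n - (n - i) = i by omega, Nat.cast_choose ℚ (by omega : n ≤ 2 * n),
          Nat.cast_choose ℚ (by omega : n - i ≤ 2 * n), Nat.cast_choose ℚ hi,
          show 2 * n - n = n by omega, show 2 * n - (n - i) = n + i by omega]
        field_simp [hne]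
  have hfin' : (∑ i ∈ Finset.range (2 * n + 1), (-1 : ℤ) ^ i * ((2 * n).choose i : ℤ) ^ 4) =
      (-1) ^ n * ((2 * n).choose n * ∑ i ∈ Finset.range (n + 1), (n.choose i : ℤ) *
        (2 * n).choose (n - i) * (2 * n + i).choose n) := by
    exact_mod_cast hfin
  simp only [pow_add, mul_assoc] at hfin' ⊢
  rw [← Finset.mul_sum, hfin', ← mul_assoc, ← mul_pow]
  simp

/-! ### Ordered factorizations as Dirichlet powers -/

open scoped ArithmeticFunction.zeta

namespace ArithmeticFunction

/-- The number of factorizations of `a` into an ordered product of `t` factors, none of them `1`. -/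
noncomputable def orderedFactorizations (t : ℕ) : ArithmeticFunction ℤ :=
  ((ζ : ArithmeticFunction ℤ) - 1) ^ t

/-- The number of factorizations of `a` into an ordered product of a positive factor and `t`
factors different from `1`. -/
noncomputable def pointedOrderedFactorizations (t : ℕ) : ArithmeticFunction ℤ :=
  (ζ : ArithmeticFunction ℤ) * orderedFactorizations t

theorem orderedFactorizations_zero_apply (a : ℕ) :
    orderedFactorizations 0 a = if a = 1 then 1 else 0 := by
  rw [orderedFactorizations, pow_zero, one_apply]

/-- The unrestricted factor is either `1` or a further factor different from `1`. -/
theorem pointedOrderedFactorizations_eq (t : ℕ) :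
    pointedOrderedFactorizations t = orderedFactorizations t + orderedFactorizations (t + 1) := by
  rw [pointedOrderedFactorizations, orderedFactorizations, orderedFactorizations, pow_succ]
  ring

theorem orderedFactorizations_succ_apply (t : ℕ) {a : ℕ} (ha : a ≠ 0) :
    orderedFactorizations (t + 1) a =
      ∑ e ∈ a.divisors.erase 1, orderedFactorizations t (a / e) := by
  rw [orderedFactorizations, pow_succ', mul_apply,
    Nat.sum_divisorsAntidiagonal fun d e ↦ ((ζ : ArithmeticFunction ℤ) - 1) d *
      (((ζ : ArithmeticFunction ℤ) - 1) ^ t) e,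
    ← Finset.add_sum_erase _ _ (Nat.one_mem_divisors.2 ha)]
  have h1 : ((ζ : ArithmeticFunction ℤ) - 1) 1 = 0 := by simp [sub_eq_add_neg]
  rw [h1, zero_mul, zero_add]
  refine Finset.sum_congr rfl fun e he ↦ ?_
  have he' := Finset.mem_erase.1 he
  have he0 : e ≠ 0 := (Nat.pos_of_mem_divisors he'.2).ne'
  have h2 : ((ζ : ArithmeticFunction ℤ) - 1) e = 1 := by
    simp [sub_eq_add_neg, he0, he'.1]
  rw [h2, one_mul]
  rfl

/-- A product of `t` factors that are at least `2` exceeds `t`. This makes it harmless to truncate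
sums over `t` at a bound `K ≥ a`, and it kills the upper end of the telescoping sum below. -/
theorem orderedFactorizations_eq_zero {t a : ℕ} (h : a ≤ t) : orderedFactorizations t a = 0 := by
  induction t generalizing a with
  | zero => simp [Nat.le_zero.1 h]
  | succ t ih =>
    rcases eq_or_ne a 0 with rfl | ha
    · simp
    rw [orderedFactorizations_succ_apply t ha]
    refine Finset.sum_eq_zero fun e he ↦ ih ?_
    have he' := Finset.mem_erase.1 he
    have he0 := Nat.pos_of_mem_divisors he'.2
    have : a / e ≤ a / 2 := Nat.div_le_div_left (by have := he'.1; omega) two_pos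
    omega

theorem sum_orderedFactorizations_succ_mul_sub (a b K : ℕ) (ha : a ≤ K) :
    ∑ t ∈ Finset.range K, (orderedFactorizations (t + 1) a * orderedFactorizations (t + 1) b -
      orderedFactorizations t a * orderedFactorizations t b) =
    -(if a = 1 ∧ b = 1 then 1 else 0) := by
  rw [Finset.sum_range_sub (fun t ↦ orderedFactorizations t a * orderedFactorizations t b) K,
    orderedFactorizations_eq_zero ha, orderedFactorizations_zero_apply,
    orderedFactorizations_zero_apply]
  by_cases h : a = 1 <;> by_cases h' : b = 1 <;> simp [h, h']

/-- The solution of the recursion that describes the factorizations of `a` and of `b` into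
interleaved ordered products. -/
theorem eq_sum_orderedFactorizations {x : ℕ → ℕ → ℤ}
    (hx : ∀ a b, a ≠ 0 → b ≠ 0 → x a b = (if a = 1 ∧ b = 1 then 1 else 0) +
      ∑ e ∈ b.divisors.erase 1, x (b / e) a) (K : ℕ) :
    ∀ a b, a ≠ 0 → b ≠ 0 → a ≤ K → b ≤ K →
      x a b = ∑ t ∈ Finset.range K, orderedFactorizations t a *
        pointedOrderedFactorizations t b := by
  -- The recursion exchanges the two arguments, so the induction runs on their product, which drops
  -- at each step.
  suffices ∀ N a b, a * b < N → a ≠ 0 → b ≠ 0 → a ≤ K → b ≤ K →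
      x a b = ∑ t ∈ Finset.range K, orderedFactorizations t a *
        pointedOrderedFactorizations t b from fun a b ↦ this (a * b + 1) a b (Nat.lt_succ_self _)
  intro N
  induction N with
  | zero => intro a b h; omega
  | succ N ih =>
    intro a b hN ha hb haK hbK
    have hrec : ∀ e ∈ b.divisors.erase 1, x (b / e) a =
        ∑ t ∈ Finset.range K, orderedFactorizations t (b / e) *
          pointedOrderedFactorizations t a := by
      intro e he
      have he' := Finset.mem_erase.1 he
      have he0 := Nat.pos_of_mem_divisors he'.2
      have hlt : b / e < b := Nat.div_lt_self (Nat.pos_of_ne_zero hb) (by have := he'.1; omega)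
      have hne : b / e ≠ 0 := (Nat.div_pos (Nat.divisor_le he'.2) he0).ne'
      refine ih _ _ ?_ hne ha (hlt.le.trans hbK) haK
      calc b / e * a < b * a := Nat.mul_lt_mul_of_pos_right hlt (Nat.pos_of_ne_zero ha)
        _ ≤ N := by rw [mul_comm]; omega
    rw [hx a b ha hb, Finset.sum_congr rfl hrec, Finset.sum_comm]
    simp only [← Finset.sum_mul, ← orderedFactorizations_succ_apply _ hb]
    have htel := sum_orderedFactorizations_succ_mul_sub a b K haK
    -- The recursion produces the claimed sum plus a telescoping term, whose total `-(if a = 1 ∧ b =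
    -- 1 then 1 else 0)` cancels the inhomogeneity.
    have : ∀ t, orderedFactorizations (t + 1) b * pointedOrderedFactorizations t a =
        orderedFactorizations t a * pointedOrderedFactorizations t b +
        (orderedFactorizations (t + 1) a * orderedFactorizations (t + 1) b -
          orderedFactorizations t a * orderedFactorizations t b) := by
      intro t
      simp only [pointedOrderedFactorizations_eq, add_apply]
      ring
    simp only [this, Finset.sum_add_distrib, htel]
    ring

theorem sum_orderedFactorizations_add (a b K : ℕ) (ha : a ≤ K) :
    ∑ t ∈ Finset.range K, orderedFactorizations t a * pointedOrderedFactorizations t b +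
      ∑ t ∈ Finset.range K, orderedFactorizations t b * pointedOrderedFactorizations t a =
    (if a = 1 ∧ b = 1 then 1 else 0) + ∑ t ∈ Finset.range K,
      pointedOrderedFactorizations t a * pointedOrderedFactorizations t b := by
  have htel := sum_orderedFactorizations_succ_mul_sub a b K ha
  have : ∀ t, pointedOrderedFactorizations t a * pointedOrderedFactorizations t b =
      orderedFactorizations t a * pointedOrderedFactorizations t b +
      orderedFactorizations t b * pointedOrderedFactorizations t a +
      (orderedFactorizations (t + 1) a * orderedFactorizations (t + 1) b -
        orderedFactorizations t a * orderedFactorizations t b) := by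
    intro t
    simp only [pointedOrderedFactorizations_eq, add_apply]
    ring
  simp only [this, Finset.sum_add_distrib, htel]
  ring

theorem zeta_pow_apply_prime_pow {p : ℕ} (hp : p.Prime) (x n : ℕ) :
    ((ζ : ArithmeticFunction ℤ) ^ (x + 1)) (p ^ n) = (n + x).choose n := by
  induction x generalizing n with
  | zero => simp [hp.ne_zero]
  | succ x ih =>
    rw [pow_succ', coe_zeta_mul_apply, Nat.sum_divisors_prime_pow hp]
    simp only [ih]
    have h := Nat.sum_range_add_choose n x
    rw [show n + (x + 1) = n + x + 1 by ring, ← Nat.choose_symm_of_eq_add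
      (show n + x + 1 = (x + 1) + n by ring), ← h]
    push_cast
    refine Finset.sum_congr rfl fun i _ ↦ ?_
    rw [Nat.choose_symm_add]

/-- This is `ζ * (1 + (ζ - 1)) ^ x` expanded by the binomial theorem in the ring of arithmetic
functions. -/
theorem sum_choose_mul_pointedOrderedFactorizations (x a : ℕ) :
    ∑ k ∈ Finset.range (x + 1), (x.choose k : ℤ) * pointedOrderedFactorizations k a =
      ((ζ : ArithmeticFunction ℤ) ^ (x + 1)) a := by
  let evalAt : ArithmeticFunction ℤ →+ ℤ :=
    { toFun := fun f ↦ f a, map_zero' := rfl, map_add' := fun _ _ ↦ rfl }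
  have h : (ζ : ArithmeticFunction ℤ) ^ (x + 1) =
      ∑ k ∈ Finset.range (x + 1), x.choose k • pointedOrderedFactorizations k := by
    have := add_pow ((ζ : ArithmeticFunction ℤ) - 1) 1 x
    rw [sub_add_cancel] at this
    rw [pow_succ', this, Finset.mul_sum]
    refine Finset.sum_congr rfl fun k _ ↦ ?_
    rw [one_pow, mul_one, pointedOrderedFactorizations, orderedFactorizations, nsmul_eq_mul]
    ring
  change _ = evalAt ((ζ : ArithmeticFunction ℤ) ^ (x + 1))
  rw [h, map_sum]
  refine Finset.sum_congr rfl fun k _ ↦ ?_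
  rw [map_nsmul, nsmul_eq_mul]
  rfl

/-- The binomial transform is triangular with unit diagonal, hence injective. -/
theorem eq_of_forall_sum_choose_mul_eq {g h : ℕ → ℤ}
    (H : ∀ x, ∑ k ∈ Finset.range (x + 1), (x.choose k : ℤ) * g k =
      ∑ k ∈ Finset.range (x + 1), (x.choose k : ℤ) * h k) : g = h := by
  funext k
  induction k using Nat.strong_induction_on with
  | _ k ih =>
    have := H k
    rw [Finset.sum_range_succ, Finset.sum_range_succ, Finset.sum_congr rfl fun i hi ↦ by
      rw [ih i (Finset.mem_range.1 hi)]] at this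
    simpa using this

theorem sum_choose_mul_pointedOrderedFactorizations_prime_pow_mul {p q n a : ℕ} (hp : p.Prime)
    (hq : q.Prime) (hpq : p ≠ q) (ha : a = p ^ n * q ^ n) (x : ℕ) :
    ∑ k ∈ Finset.range (x + 1), (x.choose k : ℤ) * pointedOrderedFactorizations k a =
      ((n + x).choose n : ℤ) ^ 2 := by
  have hmul : ((ζ : ArithmeticFunction ℤ) ^ (x + 1)).IsMultiplicative :=
    isMultiplicative_zeta.natCast.pow
  rw [sum_choose_mul_pointedOrderedFactorizations, ha,
    hmul.map_mul_of_coprime (((Nat.coprime_primes hp hq).2 hpq).pow n n),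
    zeta_pow_apply_prime_pow hp, zeta_pow_apply_prime_pow hq, sq]

/-- Both sides have the binomial transform `(n + x).choose n ^ 2`: for the right side,
`choose_sq_eq_sum` writes the square through `(x + (n + m)).choose (n + m)`, and Vandermonde makes
each of these a binomial transform. -/
theorem pointedOrderedFactorizations_prime_pow_mul {p q n a : ℕ} (hp : p.Prime) (hq : q.Prime)
    (hpq : p ≠ q) (ha : a = p ^ n * q ^ n) (k : ℕ) :
    pointedOrderedFactorizations k a = ∑ m ∈ Finset.range (n + 1),
      (-1 : ℤ) ^ (n - m) * ((n + m).choose n * n.choose m) * (n + m).choose k := by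
  refine congrFun (eq_of_forall_sum_choose_mul_eq
    (g := fun k ↦ pointedOrderedFactorizations k a)
    (h := fun k ↦ ∑ m ∈ Finset.range (n + 1),
      (-1 : ℤ) ^ (n - m) * ((n + m).choose n * n.choose m) * (n + m).choose k) fun x ↦ ?_) k
  rw [sum_choose_mul_pointedOrderedFactorizations_prime_pow_mul hp hq hpq ha,
    choose_sq_eq_sum]
  simp only [Finset.mul_sum]
  rw [Finset.sum_comm]
  refine Finset.sum_congr rfl fun m _ ↦ ?_
  rw [← Nat.choose_symm_add, add_comm x, Nat.add_choose_eq (n + m) x x,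
    Finset.Nat.sum_antidiagonal_eq_sum_range_succ_mk]
  push_cast
  rw [Finset.mul_sum]
  refine Finset.sum_congr rfl fun k hk ↦ ?_
  rw [Nat.choose_symm (Finset.mem_range_succ_iff.1 hk)]
  ring

/-- Only the factor at `b` is expanded. The sum over `k` is then the binomial transform of the
factor at `a`, taken at `n + m`; since `n + m ≤ 2 * n < K`, truncation at `K` loses nothing. -/
theorem sum_pointedOrderedFactorizations_mul {p₁ p₂ q₁ q₂ n a b K : ℕ} (hp₁ : p₁.Prime)
    (hp₂ : p₂.Prime) (hp : p₁ ≠ p₂) (hq₁ : q₁.Prime) (hq₂ : q₂.Prime) (hq : q₁ ≠ q₂)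
    (ha : a = p₁ ^ n * p₂ ^ n) (hb : b = q₁ ^ n * q₂ ^ n) (hK : 2 * n < K) :
    ∑ k ∈ Finset.range K, pointedOrderedFactorizations k a * pointedOrderedFactorizations k b =
      ∑ i ∈ Finset.range (2 * n + 1), (-1 : ℤ) ^ (n + i) * ((2 * n).choose i : ℤ) ^ 4 := by
  rw [sum_neg_one_pow_choose_pow_four, ← sum_neg_one_pow_choose_mul_choose_sq]
  simp only [pointedOrderedFactorizations_prime_pow_mul hq₁ hq₂ hq hb, Finset.mul_sum]
  rw [Finset.sum_comm]
  refine Finset.sum_congr rfl fun m hm ↦ ?_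
  have hm := Finset.mem_range_succ_iff.1 hm
  have h := sum_choose_mul_pointedOrderedFactorizations_prime_pow_mul hp₁ hp₂ hp ha (n + m)
  rw [Finset.sum_subset (Finset.range_subset_range.2 (by omega : n + m + 1 ≤ K))
    fun k _ hk ↦ by
      rw [Nat.choose_eq_zero_of_lt (by simp only [Finset.mem_range] at hk; omega)]; simp] at h
  rw [show 2 * n + m = n + (n + m) by ring, ← h, Finset.mul_sum]
  exact Finset.sum_congr rfl fun k _ ↦ by ring

end ArithmeticFunction

/-! ### Tilings of an interval and their block structure -/

/-- Every element of `{0, …, N - 1}` is, in exactly one way, the sum of an element of `A` and an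
element of `B`, and all these sums lie in `{0, …, N - 1}`. -/
structure IsIntervalTiling (A B : Finset ℕ) (N : ℕ) : Prop where
  add_lt : ∀ x ∈ A, ∀ y ∈ B, x + y < N
  exists_add : ∀ z < N, ∃ x ∈ A, ∃ y ∈ B, x + y = z
  add_inj : ∀ x ∈ A, ∀ x' ∈ A, ∀ y ∈ B, ∀ y' ∈ B, x + y = x' + y' → x = x' ∧ y = y'

namespace IsIntervalTiling

variable {A B : Finset ℕ} {N m : ℕ}

theorem symm (h : IsIntervalTiling A B N) : IsIntervalTiling B A N where
  add_lt x hx y hy := by rw [add_comm]; exact h.add_lt y hy x hx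
  exists_add z hz := by
    obtain ⟨x, hx, y, hy, e⟩ := h.exists_add z hz
    exact ⟨y, hy, x, hx, by rw [add_comm, e]⟩
  add_inj x hx x' hx' y hy y' hy' e :=
    (h.add_inj y hy y' hy' x hx x' hx' (by rw [add_comm, e, add_comm])).symm

theorem zero_mem (h : IsIntervalTiling A B N) (hN : 0 < N) : 0 ∈ A := by
  obtain ⟨x, hx, y, hy, e⟩ := h.exists_add 0 hN
  rwa [show (0 : ℕ) = x by omega]

theorem lt_of_mem (h : IsIntervalTiling A B N) (hN : 0 < N) {x : ℕ} (hx : x ∈ A) : x < N :=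
  h.add_lt x hx 0 (h.symm.zero_mem hN)

theorem eq_zero_of_mem_of_mem (h : IsIntervalTiling A B N) (hN : 0 < N) {x : ℕ} (hA : x ∈ A)
    (hB : x ∈ B) : x = 0 :=
  (h.add_inj x hA 0 (h.zero_mem hN) 0 (h.symm.zero_mem hN) x hB (by omega)).1

/-- If an initial segment of length `m` is contained in the first factor of a tiling and
`m` is not, then both factors are made of the blocks `{q * m, …, q * m + m - 1}`. -/
theorem block_structure (h : IsIntervalTiling A B N) (hN : 0 < N) (hm0 : 0 < m)
    (hlt : ∀ x < m, x ∈ A) (hm : m ∉ A) (q : ℕ) :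
    ∀ r < m, (q * m + r ∈ A ↔ q * m ∈ A) ∧ (q * m + r ∈ B → r = 0) := by
  have hA0 := h.zero_mem hN
  have hB0 := h.symm.zero_mem hN
  have hBm : ∀ y ∈ B, y < m → y = 0 := fun y hy hym ↦ h.eq_zero_of_mem_of_mem hN (hlt y hym) hy
  induction q using Nat.strong_induction_on with
  | _ q ih =>
  rcases Nat.eq_zero_or_pos q with rfl | hq
  · intro r hr
    simp only [zero_mul, zero_add]
    exact ⟨iff_of_true (hlt r hr) hA0, fun hB ↦ hBm r hB hr⟩
  have hqm : m ≤ q * m := Nat.le_mul_of_pos_left m hq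
  rcases le_or_gt N (q * m) with hNq | hNq
  · intro r _
    refine ⟨iff_of_false (fun hx ↦ ?_) fun hx ↦ ?_, fun hx ↦ ?_⟩
    · have := h.lt_of_mem hN hx; omega
    · have := h.lt_of_mem hN hx; omega
    · have := h.symm.lt_of_mem hN hx; omega
  -- In a representation `m = x + y`, `y = 0` would put `m` in `A`, and `0 < y < m` is excluded
  -- because `y` would lie in both factors.
  have hmB : m ∈ B := by
    obtain ⟨x, hx, y, hy, e⟩ := h.exists_add m (by omega)
    rcases Nat.eq_zero_or_pos y with rfl | hy0
    · rw [add_zero] at e; exact absurd (e ▸ hx) hm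
    · by_cases hym : y < m
      · have := hBm y hy hym; omega
      · rwa [show m = y by omega]
  have hdecomp : ∀ z < q * m, ∃ q' < q, ∃ r < m, z = q' * m + r := fun z hz ↦
    ⟨z / m, (Nat.div_lt_iff_lt_mul hm0).2 hz, z % m, Nat.mod_lt _ hm0, by
      rw [mul_comm, Nat.div_add_mod]⟩
  have hBdvd : ∀ y ∈ B, y < q * m → ∃ s < q, y = s * m := by
    intro y hy hyq
    obtain ⟨s, hs, r, hr, rfl⟩ := hdecomp y hyq
    obtain rfl := (ih s hs r hr).2 hy
    exact ⟨s, hs, by simp⟩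
  obtain ⟨x, hx, y, hy, e⟩ := h.exists_add (q * m) hNq
  -- The case `y = 0` means that block `q` should lie entirely in `A`; otherwise it is a translate
  -- by `y` of an earlier block of `A`.
  rcases Nat.eq_zero_or_pos y with rfl | hy0
  · rw [add_zero] at e
    subst e
    have hB : ∀ r < m, q * m + r ∈ B → r = 0 := by
      intro r hr hrB
      by_contra hr0
      -- The number `q * m + m` would be represented both as `(m - r) + (q * m + r)` and as `q * m +
      -- m`.
      have := (h.add_inj (m - r) (hlt _ (by omega)) (q * m) hx (q * m + r) hrB m hmB
        (by omega)).1
      omega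
    refine fun r hr ↦ ⟨iff_of_true ?_ hx, hB r hr⟩
    have hlast := h.add_lt (q * m) hx m hmB
    obtain ⟨x', hx', y', hy', e'⟩ := h.exists_add (q * m + r) (by omega)
    rcases Nat.eq_zero_or_pos y' with rfl | hy0'
    · rw [add_zero] at e'; rwa [← e']
    exfalso
    by_cases hy'q : y' < q * m
    · obtain ⟨s, hs, rfl⟩ := hBdvd y' hy' hy'q
      have hs0 : 0 < s := Nat.pos_of_mul_pos_right hy0'
      obtain ⟨t, rfl⟩ := Nat.exists_eq_add_of_le hs.le
      rw [add_mul] at e' hx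
      -- By induction `t * m ∈ A`, so with `q = s + t` the number `q * m` has the two
      -- representations `t * m + s * m` and `q * m + 0`.
      obtain rfl : x' = t * m + r := by omega
      have ht := (ih t (by omega) r hr).1.1 hx'
      have := (h.add_inj _ ht _ hx _ hy' 0 hB0 (by ring)).2
      omega
    · have hrr := hB (y' - q * m) (by omega) (by rwa [Nat.add_sub_cancel' (by omega)])
      have := h.eq_zero_of_mem_of_mem hN hx (by rwa [show q * m = y' by omega])
      omega
  · obtain ⟨t, ht, r₀, hr₀, rfl⟩ := hdecomp x (by omega)
    have hr0 : r₀ = 0 := by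
      by_contra hne
      by_cases hyq : y < q * m
      · obtain ⟨s, _, rfl⟩ := hBdvd y hy hyq
        have h1 : m ∣ t * m + r₀ + s * m := e ▸ Dvd.intro_left q rfl
        have h2 : m ∣ r₀ := by
          have := (Nat.dvd_add_left (Dvd.intro_left s rfl : m ∣ s * m)).1 h1
          exact (Nat.dvd_add_right (Dvd.intro_left t rfl : m ∣ t * m)).1 this
        exact absurd (Nat.le_of_dvd (by omega) h2) (by omega)
      · omega
    subst hr0
    -- Block `q` is already covered by block `t` of `A` plus `y`. An element of `A` there, added to
    -- `0 ∈ B`, contradicts uniqueness; for an element of `B`, added to `0 ∈ A`, uniqueness forces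
    -- `r = 0`.
    have hblock : ∀ r < m, t * m + r ∈ A := fun r hr ↦ (ih t ht r hr).1.2 (by simpa using hx)
    have hnot : ∀ r < m, q * m + r ∉ A := by
      intro r hr hrA
      have := (h.add_inj _ hrA _ (hblock r hr) 0 hB0 y hy (by omega)).2
      omega
    refine fun r hr ↦ ⟨iff_of_false (hnot r hr) (by simpa using hnot 0 hm0), fun hrB ↦ ?_⟩
    have := (h.add_inj 0 hA0 _ (hblock r hr) _ hrB y hy (by omega)).1
    omega

end IsIntervalTiling

/-- The set of all `x` with `x / m ∈ A`. -/
def inflate (m : ℕ) (A : Finset ℕ) : Finset ℕ :=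
  (A ×ˢ Finset.range m).image fun p ↦ p.1 * m + p.2

/-- The set of the multiples by `m` of the elements of `B`. -/
def dilate (m : ℕ) (B : Finset ℕ) : Finset ℕ := B.image (· * m)

theorem mem_inflate {m : ℕ} (hm : 0 < m) {A : Finset ℕ} {x : ℕ} : x ∈ inflate m A ↔ x / m ∈ A := by
  simp only [inflate, Finset.mem_image, Finset.mem_product, Finset.mem_range, Prod.exists]
  constructor
  · rintro ⟨q, r, ⟨hq, hr⟩, rfl⟩
    rwa [mul_comm, Nat.mul_add_div hm, Nat.div_eq_of_lt hr, add_zero]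
  · intro h
    exact ⟨x / m, x % m, ⟨h, Nat.mod_lt _ hm⟩, by rw [mul_comm, Nat.div_add_mod]⟩

theorem mul_add_mem_inflate {m : ℕ} {A : Finset ℕ} {q r : ℕ} (hr : r < m) :
    q * m + r ∈ inflate m A ↔ q ∈ A := by
  rw [mem_inflate (by omega), mul_comm, Nat.mul_add_div (by omega), Nat.div_eq_of_lt hr, add_zero]

theorem mul_mem_inflate {m : ℕ} (hm : 0 < m) {A : Finset ℕ} {q : ℕ} :
    q * m ∈ inflate m A ↔ q ∈ A := mul_add_mem_inflate hm (r := 0)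

theorem mul_mem_dilate {m : ℕ} (hm : 0 < m) {B : Finset ℕ} {q : ℕ} :
    q * m ∈ dilate m B ↔ q ∈ B := by
  simp [dilate, hm.ne']

theorem card_inflate (m : ℕ) (A : Finset ℕ) : (inflate m A).card = A.card * m := by
  rw [inflate, Finset.card_image_of_injOn, Finset.card_product, Finset.card_range]
  rintro ⟨q, r⟩ h ⟨q', r'⟩ h' e
  simp only [Finset.coe_product, Set.mem_prod, Finset.mem_coe, Finset.mem_range] at h h' e
  have hm : 0 < m := by omega
  have e1 := congrArg (· / m) e
  simp only [mul_comm _ m, Nat.mul_add_div hm, Nat.div_eq_of_lt h.2, Nat.div_eq_of_lt h'.2,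
    add_zero] at e1
  subst e1
  simpa using e

theorem card_dilate {m : ℕ} (hm : 0 < m) (B : Finset ℕ) : (dilate m B).card = B.card :=
  Finset.card_image_of_injective _ fun _ _ h ↦ Nat.eq_of_mul_eq_mul_right hm h

theorem isIntervalTiling_inflate_dilate {A B : Finset ℕ} {N m : ℕ} (hm : 0 < m) :
    IsIntervalTiling (inflate m A) (dilate m B) (N * m) ↔ IsIntervalTiling A B N := by
  constructor
  · intro h
    refine ⟨fun x hx y hy ↦ ?_, fun z hz ↦ ?_, fun x hx x' hx' y hy y' hy' e ↦ ?_⟩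
    · have := h.add_lt _ ((mul_mem_inflate hm).2 hx) _ ((mul_mem_dilate hm).2 hy)
      rw [← add_mul] at this
      exact Nat.lt_of_mul_lt_mul_right this
    · obtain ⟨x, hx, y, hy, e⟩ := h.exists_add (z * m) (Nat.mul_lt_mul_of_pos_right hz hm)
      simp only [dilate, Finset.mem_image] at hy
      obtain ⟨y, hy, rfl⟩ := hy
      rw [mem_inflate hm] at hx
      refine ⟨_, hx, y, hy, ?_⟩
      rw [← Nat.add_mul_div_right _ _ hm, e, Nat.mul_div_cancel _ hm]
    · have := h.add_inj _ ((mul_mem_inflate hm).2 hx) _ ((mul_mem_inflate hm).2 hx') _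
        ((mul_mem_dilate hm).2 hy) _ ((mul_mem_dilate hm).2 hy') (by rw [← add_mul, e, add_mul])
      exact ⟨Nat.eq_of_mul_eq_mul_right hm this.1, Nat.eq_of_mul_eq_mul_right hm this.2⟩
  · intro h
    have hdil : ∀ y ∈ dilate m B, ∃ y' ∈ B, y' * m = y := fun y hy ↦ Finset.mem_image.1 hy
    refine ⟨fun x hx y hy ↦ ?_, fun z hz ↦ ?_, fun x hx x' hx' y hy y' hy' e ↦ ?_⟩
    · obtain ⟨y, hyB, rfl⟩ := hdil y hy
      rw [← Nat.div_lt_iff_lt_mul hm, Nat.add_mul_div_right _ _ hm]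
      exact h.add_lt _ ((mem_inflate hm).1 hx) y hyB
    · obtain ⟨x, hx, y, hy, e⟩ := h.exists_add (z / m) ((Nat.div_lt_iff_lt_mul hm).2 hz)
      refine ⟨x * m + z % m, (mul_add_mem_inflate (Nat.mod_lt _ hm)).2 hx, y * m,
        (mul_mem_dilate hm).2 hy, ?_⟩
      rw [add_right_comm, ← add_mul, e, mul_comm, Nat.div_add_mod]
    · obtain ⟨y, hyB, rfl⟩ := hdil y hy
      obtain ⟨y', hyB', rfl⟩ := hdil y' hy'
      have e1 := congrArg (· / m) e
      simp only [Nat.add_mul_div_right _ _ hm] at e1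
      have := (h.add_inj _ ((mem_inflate hm).1 hx) _ ((mem_inflate hm).1 hx') y hyB y' hyB' e1).2
      subst this
      exact ⟨by omega, rfl⟩

/-- A tiling whose first factor contains `1` is obtained from a tiling whose first factor does
not contain `1` by replacing every point by a block. -/
theorem IsIntervalTiling.exists_inflate_dilate {A B : Finset ℕ} {N : ℕ}
    (h : IsIntervalTiling A B N) (hN : 0 < N) (h1 : 1 ∈ A) :
    ∃ m A' B', 2 ≤ m ∧ 1 ∉ A' ∧ A = inflate m A' ∧ B = dilate m B' := by
  have hex : ∃ m, m ∉ A := ⟨N, fun hx ↦ (h.lt_of_mem hN hx).false⟩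
  classical
  -- The length of the initial run of `A`.
  let m := Nat.find hex
  have hm : m ∉ A := Nat.find_spec hex
  have hlt : ∀ x < m, x ∈ A := fun x hx ↦ not_not.1 (Nat.find_min hex hx)
  have hm2 : 2 ≤ m := by
    by_contra hlt2
    have h0 := h.zero_mem hN
    interval_cases hm' : m
    · exact hm h0
    · exact hm h1
  have hm0 : 0 < m := by omega
  have hinj : Function.Injective (· * m) := fun _ _ h ↦ Nat.eq_of_mul_eq_mul_right hm0 h
  have hb := h.block_structure hN hm0 hlt hm
  refine ⟨m, A.preimage (· * m) hinj.injOn, B.preimage (· * m) hinj.injOn, hm2, by simpa, ?_, ?_⟩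
  · ext x
    rw [mem_inflate hm0, Finset.mem_preimage, ← (hb (x / m) (x % m) (Nat.mod_lt _ hm0)).1,
      mul_comm, Nat.div_add_mod]
  · ext y
    simp only [dilate, Finset.mem_image, Finset.mem_preimage]
    constructor
    · intro hy
      have e : y / m * m + y % m = y := by rw [mul_comm, Nat.div_add_mod]
      have := (hb (y / m) (y % m) (Nat.mod_lt _ hm0)).2 (by rwa [e])
      rw [this, add_zero] at e
      exact ⟨y / m, by rwa [e], e⟩
    · rintro ⟨q, hq, rfl⟩
      exact hq

/-! ### Counting tilings by recursion on the block length -/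

open Classical in
/-- The tilings of `{0, …, a * b - 1}` whose factors have `a` and `b` elements. -/
noncomputable def intervalTilings (a b : ℕ) : Finset (Finset ℕ × Finset ℕ) :=
  ((Finset.range (a * b)).powerset ×ˢ (Finset.range (a * b)).powerset).filter fun S ↦
    S.1.card = a ∧ S.2.card = b ∧ IsIntervalTiling S.1 S.2 (a * b)

section Count

variable {a b : ℕ}

theorem mem_intervalTilings (ha : a ≠ 0) (hb : b ≠ 0) {S : Finset ℕ × Finset ℕ} :
    S ∈ intervalTilings a b ↔
      S.1.card = a ∧ S.2.card = b ∧ IsIntervalTiling S.1 S.2 (a * b) := by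
  simp only [intervalTilings, Finset.mem_filter, Finset.mem_product, Finset.mem_powerset,
    and_iff_right_iff_imp]
  rintro ⟨-, -, h⟩
  have hN : 0 < a * b := by positivity
  exact ⟨fun x hx ↦ Finset.mem_range.2 (h.lt_of_mem hN hx),
    fun x hx ↦ Finset.mem_range.2 (h.symm.lt_of_mem hN hx)⟩

theorem swap_mem_intervalTilings (ha : a ≠ 0) (hb : b ≠ 0) {S : Finset ℕ × Finset ℕ} :
    S.swap ∈ intervalTilings b a ↔ S ∈ intervalTilings a b := by
  rw [mem_intervalTilings ha hb, mem_intervalTilings hb ha, mul_comm b a]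
  exact ⟨fun ⟨h1, h2, h3⟩ ↦ ⟨h2, h1, h3.symm⟩, fun ⟨h1, h2, h3⟩ ↦ ⟨h2, h1, h3.symm⟩⟩

/-- In an interval with more than one point, `1` belongs to exactly one factor, so swapping the
factors is a bijection. The extra `1` is the tiling `({0}, {0})`, in which neither factor contains
`1`. -/
theorem card_filter_one_notMem (ha : a ≠ 0) (hb : b ≠ 0) :
    ((intervalTilings a b).filter fun S ↦ 1 ∉ S.1).card =
      (if a = 1 ∧ b = 1 then 1 else 0) +
        ((intervalTilings b a).filter fun S ↦ 1 ∈ S.1).card := by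
  have hN : 0 < a * b := by positivity
  split_ifs with h
  · obtain ⟨rfl, rfl⟩ := h
    have hsub : ∀ S ∈ intervalTilings 1 1, ∀ x, (x ∈ S.1 ↔ x = 0) ∧ (x ∈ S.2 ↔ x = 0) := by
      intro S hS x
      have hS := ((mem_intervalTilings one_ne_zero one_ne_zero).1 hS).2.2
      refine ⟨⟨fun hx ↦ ?_, fun hx ↦ hx ▸ hS.zero_mem one_pos⟩, fun hx ↦ ?_,
        fun hx ↦ hx ▸ hS.symm.zero_mem one_pos⟩
      · have := hS.lt_of_mem one_pos hx; omega
      · have := hS.symm.lt_of_mem one_pos hx; omega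
    have h1 : (intervalTilings 1 1).filter (fun S ↦ 1 ∈ S.1) = ∅ := by
      refine Finset.filter_eq_empty_iff.2 fun S hS h ↦ ?_
      simpa using (hsub S hS 1).1.1 h
    have h2 : (intervalTilings 1 1).filter (fun S ↦ 1 ∉ S.1) = {({0}, {0})} := by
      ext S
      rw [Finset.mem_filter, Finset.mem_singleton]
      constructor
      · rintro ⟨hS, -⟩
        refine Prod.ext ?_ ?_ <;> ext x <;> simp [hsub S hS x]
      · rintro rfl
        refine ⟨(mem_intervalTilings one_ne_zero one_ne_zero).2 ⟨rfl, rfl, ?_, ?_, ?_⟩, by simp⟩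
        all_goals simp
    rw [h1, h2]
    simp
  · rw [zero_add]
    have hN2 : 1 < a * b := by
      by_contra hle
      have : a * b = 1 := by omega
      exact h (mul_eq_one.1 this)
    have hiff : ∀ S ∈ intervalTilings a b, (1 ∉ S.1 ↔ 1 ∈ S.2) := by
      intro S hS
      have hS := ((mem_intervalTilings ha hb).1 hS).2.2
      constructor
      · intro h1
        obtain ⟨x, hx, y, hy, e⟩ := hS.exists_add 1 hN2
        have : x ≠ 1 := fun hx1 ↦ h1 (hx1 ▸ hx)
        rwa [show 1 = y by omega]
      · intro h2 h1
        simpa using hS.eq_zero_of_mem_of_mem hN h1 h2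
    refine Finset.card_bij' (fun S _ ↦ S.swap) (fun S _ ↦ S.swap) (fun S hS ↦ ?_) (fun S hS ↦ ?_)
      (fun _ _ ↦ rfl) fun _ _ ↦ rfl
    · rw [Finset.mem_filter] at hS ⊢
      exact ⟨(swap_mem_intervalTilings ha hb).2 hS.1, (hiff S hS.1).1 hS.2⟩
    · rw [Finset.mem_filter] at hS ⊢
      have := (swap_mem_intervalTilings hb ha).2 hS.1
      exact ⟨this, (hiff _ this).2 hS.2⟩

/-- Tilings are sorted by the initial run length `e` of the first factor, which divides `a` because
that factor is a union of blocks of length `e`. Contracting the blocks leaves a first factor of size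
`a / e` without `1`. -/
theorem card_filter_one_mem (ha : a ≠ 0) (hb : b ≠ 0) :
    ((intervalTilings a b).filter fun S ↦ 1 ∈ S.1).card =
      ∑ e ∈ a.divisors.erase 1,
        ((intervalTilings (a / e) b).filter fun S ↦ 1 ∉ S.1).card := by
  have hN : 0 < a * b := by positivity
  have hdiv : ∀ e ∈ a.divisors.erase 1, 2 ≤ e ∧ a / e * e = a ∧ a / e ≠ 0 := by
    intro e he
    have he' := Finset.mem_erase.1 he
    have he0 := Nat.pos_of_mem_divisors he'.2
    refine ⟨by have := he'.1; omega, Nat.div_mul_cancel (Nat.dvd_of_mem_divisors he'.2),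
      (Nat.div_pos (Nat.divisor_le he'.2) he0).ne'⟩
  rw [← Finset.card_sigma]
  symm
  refine Finset.card_bij (fun p _ ↦ (inflate p.1 p.2.1, dilate p.1 p.2.2)) ?_ ?_ ?_
  · rintro ⟨e, A, B⟩ h
    obtain ⟨he, h⟩ := Finset.mem_sigma.1 h
    obtain ⟨he2, hae, hne⟩ := hdiv e he
    have h := (mem_intervalTilings hne hb).1 (Finset.mem_filter.1 h).1
    simp only at h ⊢
    have he0 : 0 < e := by omega
    rw [Finset.mem_filter, mem_intervalTilings ha hb]
    refine ⟨⟨?_, ?_, ?_⟩, ?_⟩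
    · rw [card_inflate, h.1, hae]
    · rw [card_dilate he0, h.2.1]
    · have := (isIntervalTiling_inflate_dilate he0).2 h.2.2
      rwa [mul_right_comm, hae] at this
    · rw [mem_inflate he0, Nat.div_eq_of_lt (by omega)]
      exact h.2.2.zero_mem (by positivity)
  -- The run length is recovered from the inflated set: if `e < e'`, then `e` lies in the initial
  -- block of `inflate e' A'`, but `1 ∉ A` keeps it out of `inflate e A`.
  · have key : ∀ {e e' : ℕ} {A A' : Finset ℕ}, 0 < e → 0 < e' → 1 ∉ A → 0 ∈ A' →
        inflate e A = inflate e' A' → e' ≤ e := by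
      intro e e' A A' he he' h1 h0 heq
      by_contra hlt
      have h2 : e ∈ inflate e' A' := by
        rw [mem_inflate he', Nat.div_eq_of_lt (by omega)]; exact h0
      rw [← heq, mem_inflate he, Nat.div_self he] at h2
      exact h1 h2
    rintro ⟨e, A, B⟩ h ⟨e', A', B'⟩ h' heq
    obtain ⟨he, h⟩ := Finset.mem_sigma.1 h
    obtain ⟨he', h'⟩ := Finset.mem_sigma.1 h'
    obtain ⟨h, h1⟩ := Finset.mem_filter.1 h
    obtain ⟨h', h1'⟩ := Finset.mem_filter.1 h'
    obtain ⟨he2, -, hne⟩ := hdiv e he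
    obtain ⟨he2', -, hne'⟩ := hdiv e' he'
    have h := (mem_intervalTilings hne hb).1 h
    have h' := (mem_intervalTilings hne' hb).1 h'
    simp only [Prod.mk.injEq] at h h' h1 h1' heq he2 he2' hne hne'
    have he0 : 0 < e := by omega
    have he0' : 0 < e' := by omega
    obtain rfl : e = e' := le_antisymm
      (key he0' he0 h1' (h.2.2.zero_mem (by positivity)) heq.1.symm)
      (key he0 he0' h1 (h'.2.2.zero_mem (by positivity)) heq.1)
    have hA : A = A' := by
      ext x
      rw [← mul_mem_inflate he0, heq.1, mul_mem_inflate he0]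
    have hB : B = B' := by
      ext x
      rw [← mul_mem_dilate he0, heq.2, mul_mem_dilate he0]
    rw [hA, hB]
  · rintro ⟨A, B⟩ h
    obtain ⟨h, h1⟩ := Finset.mem_filter.1 h
    obtain ⟨hA, hB, ht⟩ := (mem_intervalTilings ha hb).1 h
    obtain ⟨m, A', B', hm2, h1', rfl, rfl⟩ := ht.exists_inflate_dilate hN h1
    have hm0 : 0 < m := by omega
    simp only [card_inflate, card_dilate hm0] at hA hB
    have hdvd : m ∣ a := Dvd.intro_left _ hA
    have hcard : A'.card = a / m := by rw [← hA, Nat.mul_div_cancel _ hm0]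
    have hmem : m ∈ a.divisors.erase 1 :=
      Finset.mem_erase.2 ⟨by omega, Nat.mem_divisors.2 ⟨hdvd, ha⟩⟩
    refine ⟨⟨m, A', B'⟩, Finset.mem_sigma.2 ⟨hmem, Finset.mem_filter.2 ⟨?_, h1'⟩⟩, rfl⟩
    refine (mem_intervalTilings (hdiv m hmem).2.2 hb).2 ⟨hcard, hB, ?_⟩
    rw [← isIntervalTiling_inflate_dilate hm0, mul_right_comm, (hdiv m hmem).2.1]
    exact ht

open ArithmeticFunction in
/-- The number of tilings of an interval, in terms of the ordered factorizations of the
cardinalities of the factors. -/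
theorem card_intervalTilings (ha : a ≠ 0) (hb : b ≠ 0) {K : ℕ} (haK : a ≤ K) (hbK : b ≤ K) :
    ((intervalTilings a b).card : ℤ) = ∑ t ∈ Finset.range K,
      pointedOrderedFactorizations t a * pointedOrderedFactorizations t b := by
  let x : ℕ → ℕ → ℤ := fun a b ↦ ((intervalTilings a b).filter fun S ↦ 1 ∉ S.1).card
  have hx : ∀ a b, a ≠ 0 → b ≠ 0 → x a b = (if a = 1 ∧ b = 1 then 1 else 0) +
      ∑ e ∈ b.divisors.erase 1, x (b / e) a := by
    intro a b ha hb
    simp only [x, card_filter_one_notMem ha hb, card_filter_one_mem hb ha]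
    push_cast
    rfl
  have hsum := sum_orderedFactorizations_add a b K haK
  rw [← eq_sum_orderedFactorizations hx K a b ha hb haK hbK,
    ← eq_sum_orderedFactorizations hx K b a hb ha hbK haK] at hsum
  -- Up to the trivial tiling, `x b a` counts the tilings with `1` in the first factor, so `x a b +
  -- x b a` is the total count plus that correction.
  have hy : x b a = (if a = 1 ∧ b = 1 then 1 else 0) +
      (((intervalTilings a b).filter fun S ↦ 1 ∈ S.1).card : ℤ) := by
    simp only [x, card_filter_one_notMem hb ha, and_comm (a := b = 1)]
    push_cast
    rfl
  have hcard := Finset.card_filter_add_card_filter_not (s := intervalTilings a b) fun S ↦ 1 ∈ S.1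
  have hcard' : ((intervalTilings a b).card : ℤ) =
      ((intervalTilings a b).filter fun S ↦ 1 ∈ S.1).card + x a b := by
    rw [← hcard]; push_cast; rfl
  linarith

end Count

/-! ### Labelings of `K_{a,b}` as pairs of label sets -/

theorem completeBipartiteGraph_bijOn_edgeSet (V W : Type*) :
    Set.BijOn (fun p : V × W ↦ s(Sum.inl p.1, Sum.inr p.2)) Set.univ
      (completeBipartiteGraph V W).edgeSet := by
  refine ⟨fun p _ ↦ by simp, ?_, ?_⟩
  · rintro ⟨i, j⟩ _ ⟨i', j'⟩ _ h
    simpa using h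
  · intro e
    induction e using Sym2.ind with
    | _ u v =>
      intro h
      rw [SimpleGraph.mem_edgeSet, completeBipartiteGraph_adj] at h
      rcases u with i | j <;> rcases v with i' | j'
      · simp at h
      · exact ⟨(i, j'), trivial, rfl⟩
      · exact ⟨(i', j), trivial, Sym2.eq_swap⟩
      · simp at h

theorem ncard_edgeSet_completeBipartiteGraph (a b : ℕ) :
    (completeBipartiteGraph (Fin a) (Fin b)).edgeSet.ncard = a * b := by
  have h := completeBipartiteGraph_bijOn_edgeSet (Fin a) (Fin b)
  rw [← h.image_eq, h.injOn.ncard_image, Set.ncard_univ]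
  simp

section Graceful

variable {a b : ℕ}

theorem isAlphaGraceful_completeBipartiteGraph_iff {f : Fin a ⊕ Fin b → ℕ} :
    IsAlphaGraceful (completeBipartiteGraph (Fin a) (Fin b)) (Set.range Sum.inl)
      (Set.range Sum.inr) f ↔
    (∀ v, f v ≤ a * b) ∧ (∀ i j, f (Sum.inl i) < f (Sum.inr j)) ∧
      Set.BijOn (fun p : Fin a × Fin b ↦ f (Sum.inr p.2) - f (Sum.inl p.1)) Set.univ
        (Set.Icc 1 (a * b)) := by
  have hcard := ncard_edgeSet_completeBipartiteGraph a b
  have hbij := completeBipartiteGraph_bijOn_edgeSet (Fin a) (Fin b)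
  have hlabel : (∀ i j, f (Sum.inl i) < f (Sum.inr j)) → ∀ p : Fin a × Fin b,
      edgeLabel f s(Sum.inl p.1, Sum.inr p.2) = f (Sum.inr p.2) - f (Sum.inl p.1) := by
    intro h p
    have := h p.1 p.2
    change ((f (Sum.inl p.1) : ℤ) - (f (Sum.inr p.2) : ℤ)).natAbs = _
    omega
  constructor
  · rintro ⟨h1, h2, h3⟩
    rw [hcard] at h1 h3
    have h2' : ∀ i j, f (Sum.inl i) < f (Sum.inr j) := fun i j ↦ h2 _ ⟨i, rfl⟩ _ ⟨j, rfl⟩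
    exact ⟨h1, h2', (h3.comp hbij).congr fun p _ ↦ hlabel h2' p⟩
  · rintro ⟨h1, h2, h3⟩
    refine ⟨by rwa [hcard], ?_, ?_⟩
    · rintro _ ⟨i, rfl⟩ _ ⟨j, rfl⟩
      exact h2 i j
    · rw [hcard]
      have h3' := h3.congr fun p _ ↦ (hlabel h2 p).symm
      refine ⟨?_, ?_, ?_⟩
      · rw [← hbij.image_eq]
        rintro _ ⟨p, hp, rfl⟩
        exact h3'.mapsTo hp
      · rw [← hbij.image_eq]
        rintro _ ⟨p, hp, rfl⟩ _ ⟨q, hq, rfl⟩ e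
        rw [h3'.injOn hp hq e]
      · intro z hz
        obtain ⟨p, hp, rfl⟩ := h3'.surjOn hz
        exact ⟨_, hbij.mapsTo hp, rfl⟩

/-- The pair of the sets of labels in the left and in the right part. -/
def labelSets (f : Fin a ⊕ Fin b → ℕ) : Finset ℕ × Finset ℕ :=
  (Finset.univ.image (f ∘ Sum.inl), Finset.univ.image (f ∘ Sum.inr))

theorem injective_of_bijOn_sub {f : Fin a ⊕ Fin b → ℕ} (ha : a ≠ 0) (hb : b ≠ 0)
    (h : Set.BijOn (fun p : Fin a × Fin b ↦ f (Sum.inr p.2) - f (Sum.inl p.1)) Set.univ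
        (Set.Icc 1 (a * b))) :
    Function.Injective (f ∘ Sum.inl) ∧ Function.Injective (f ∘ Sum.inr) := by
  have i₀ : Fin a := ⟨0, Nat.pos_of_ne_zero ha⟩
  have j₀ : Fin b := ⟨0, Nat.pos_of_ne_zero hb⟩
  constructor
  · intro i i' e
    have := h.injOn (Set.mem_univ (i, j₀)) (Set.mem_univ (i', j₀)) (by
      simp only [Function.comp_apply] at e; simp only [e])
    exact congrArg Prod.fst this
  · intro j j' e
    have := h.injOn (Set.mem_univ (i₀, j)) (Set.mem_univ (i₀, j')) (by
      simp only [Function.comp_apply] at e; simp only [e])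
    exact congrArg Prod.snd this

theorem labelSets_mem_differencePairs {f : Fin a ⊕ Fin b → ℕ} (ha : a ≠ 0) (hb : b ≠ 0)
    (hf : IsAlphaGraceful (completeBipartiteGraph (Fin a) (Fin b)) (Set.range Sum.inl)
      (Set.range Sum.inr) f) : labelSets f ∈ differencePairs a b := by
  obtain ⟨h1, h2, h3⟩ := isAlphaGraceful_completeBipartiteGraph_iff.1 hf
  obtain ⟨hl, hr⟩ := injective_of_bijOn_sub ha hb h3
  refine ⟨fun x hx ↦ ?_, fun x hx ↦ ?_, ?_, ?_, ?_⟩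
  · obtain ⟨i, -, rfl⟩ := Finset.mem_image.1 hx
    exact Finset.mem_Icc.2 ⟨Nat.zero_le _, h1 _⟩
  · obtain ⟨i, -, rfl⟩ := Finset.mem_image.1 hx
    exact Finset.mem_Icc.2 ⟨Nat.zero_le _, h1 _⟩
  · simp [labelSets, Finset.card_image_of_injective _ hl]
  · simp [labelSets, Finset.card_image_of_injective _ hr]
  · ext z
    simp only [labelSets, Finset.mem_image, Finset.mem_univ, true_and, Function.comp_apply,
      Set.mem_ofPred_eq, Set.mem_Icc, exists_exists_eq_and]
    constructor
    · rintro ⟨i, j, rfl⟩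
      have := h3.mapsTo (Set.mem_univ (i, j))
      simp only [Set.mem_Icc] at this
      have := h2 i j
      zify at *
      omega
    · rintro ⟨hz1, hz2⟩
      lift z to ℕ using by omega
      obtain ⟨⟨i, j⟩, -, e⟩ := h3.surjOn (show z ∈ Set.Icc 1 (a * b) from
        ⟨by omega, by exact_mod_cast hz2⟩)
      have := h2 i j
      exact ⟨i, j, by simp only at e; omega⟩

theorem lt_of_mem_differencePairs {S : Finset ℕ × Finset ℕ} (hS : S ∈ differencePairs a b)
    {x y : ℕ} (hx : x ∈ S.1) (hy : y ∈ S.2) : x < y ∧ y - x ≤ a * b := by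
  have : (y : ℤ) - x ∈ Set.Icc 1 ((a : ℤ) * (b : ℤ)) := hS.2.2.2.2 ▸ ⟨x, hx, y, hy, rfl⟩
  rw [← Nat.cast_mul, Set.mem_Icc] at this
  omega

theorem exists_sub_eq_of_mem_differencePairs {S : Finset ℕ × Finset ℕ}
    (hS : S ∈ differencePairs a b) {z : ℕ} (hz : 1 ≤ z) (hz' : z ≤ a * b) :
    ∃ x ∈ S.1, ∃ y ∈ S.2, y = x + z := by
  have : (z : ℤ) ∈ {z : ℤ | ∃ x ∈ S.1, ∃ y ∈ S.2, z = (y : ℤ) - (x : ℤ)} := by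
    rw [hS.2.2.2.2, ← Nat.cast_mul, Set.mem_Icc]
    omega
  obtain ⟨x, hx, y, hy, e⟩ := this
  exact ⟨x, hx, y, hy, by omega⟩

/-- Injectivity is free by counting: `a * b` pairs map onto a set of `a * b` differences. -/
theorem bijOn_sub_of_mem_differencePairs {S : Finset ℕ × Finset ℕ}
    (hS : S ∈ differencePairs a b) :
    Set.BijOn (fun p : ℕ × ℕ ↦ p.2 - p.1) ↑(S.1 ×ˢ S.2) (Set.Icc 1 (a * b)) := by
  have himage : (S.1 ×ˢ S.2).image (fun p : ℕ × ℕ ↦ p.2 - p.1) = Finset.Icc 1 (a * b) := by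
    ext z
    simp only [Finset.mem_image, Finset.mem_product, Finset.mem_Icc, Prod.exists]
    constructor
    · rintro ⟨x, y, ⟨hx, hy⟩, rfl⟩
      have := lt_of_mem_differencePairs hS hx hy
      omega
    · rintro ⟨hz, hz'⟩
      obtain ⟨x, hx, y, hy, e⟩ := exists_sub_eq_of_mem_differencePairs hS hz hz'
      exact ⟨x, y, ⟨hx, hy⟩, by omega⟩
  have hinj : Set.InjOn (fun p : ℕ × ℕ ↦ p.2 - p.1) ↑(S.1 ×ˢ S.2) := by
    rw [← Finset.card_image_iff, himage, Finset.card_product, hS.2.2.1, hS.2.2.2.1]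
    simp
  have := hinj.bijOn_image
  rwa [← Finset.coe_image, himage, Finset.coe_Icc] at this

theorem exists_labelSets_eq {S : Finset ℕ × Finset ℕ} (hS : S ∈ differencePairs a b) :
    ∃ f : Fin a ⊕ Fin b → ℕ, IsAlphaGraceful (completeBipartiteGraph (Fin a) (Fin b))
      (Set.range Sum.inl) (Set.range Sum.inr) f ∧ labelSets f = S := by
  let l := S.1.orderEmbOfFin hS.2.2.1
  let r := S.2.orderEmbOfFin hS.2.2.2.1
  have hl : ∀ i, l i ∈ S.1 := S.1.orderEmbOfFin_mem hS.2.2.1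
  have hr : ∀ j, r j ∈ S.2 := S.2.orderEmbOfFin_mem hS.2.2.2.1
  have hl' : ∀ x ∈ S.1, ∃ i, l i = x := fun x hx ↦ by
    have : x ∈ Set.range l := by
      rw [Finset.range_orderEmbOfFin]; exact hx
    exact this
  have hr' : ∀ x ∈ S.2, ∃ i, r i = x := fun x hx ↦ by
    have : x ∈ Set.range r := by
      rw [Finset.range_orderEmbOfFin]; exact hx
    exact this
  have hbij := bijOn_sub_of_mem_differencePairs hS
  refine ⟨Sum.elim l r, isAlphaGraceful_completeBipartiteGraph_iff.2 ⟨?_, ?_, ?_, ?_, ?_⟩, ?_⟩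
  · rintro (i | j)
    · exact (Finset.mem_Icc.1 (hS.1 (hl i))).2
    · exact (Finset.mem_Icc.1 (hS.2.1 (hr j))).2
  · exact fun i j ↦ (lt_of_mem_differencePairs hS (hl i) (hr j)).1
  · rintro ⟨i, j⟩ -
    exact hbij.mapsTo (x := (l i, r j)) (Finset.mem_coe.2 (Finset.mk_mem_product (hl i) (hr j)))
  · rintro ⟨i, j⟩ - ⟨i', j'⟩ - e
    have := hbij.injOn (Finset.mem_coe.2 (Finset.mk_mem_product (hl i) (hr j)))
      (Finset.mem_coe.2 (Finset.mk_mem_product (hl i') (hr j'))) e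
    simpa using this
  · intro z hz
    obtain ⟨⟨x, y⟩, hxy, e⟩ := hbij.surjOn hz
    obtain ⟨hx, hy⟩ := Finset.mem_product.1 (Finset.mem_coe.1 hxy)
    obtain ⟨i, rfl⟩ := hl' x hx
    obtain ⟨j, rfl⟩ := hr' y hy
    exact ⟨(i, j), trivial, e⟩
  · refine Prod.ext ?_ ?_ <;> ext x <;>
      simp only [labelSets, Finset.mem_image, Finset.mem_univ, true_and, Function.comp_apply,
        Sum.elim_inl, Sum.elim_inr]
    · exact ⟨fun ⟨i, e⟩ ↦ e ▸ hl i, hl' x⟩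
    · exact ⟨fun ⟨i, e⟩ ↦ e ▸ hr i, hr' x⟩

/-- An automorphism that transforms one α-graceful labeling of a complete bipartite graph into
another one preserves the two parts. -/
theorem exists_apply_eq_of_isAlphaGraceful {f g : Fin a ⊕ Fin b → ℕ}
    (hf : ∀ i j, f (Sum.inl i) < f (Sum.inr j)) (hg : ∀ i j, g (Sum.inl i) < g (Sum.inr j))
    (ha : a ≠ 0) (hb : b ≠ 0)
    (φ : completeBipartiteGraph (Fin a) (Fin b) ≃g completeBipartiteGraph (Fin a) (Fin b))
    (h : ∀ v, g v = f (φ v)) :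
    (∀ i, ∃ i', φ (Sum.inl i) = Sum.inl i') ∧ ∀ j, ∃ j', φ (Sum.inr j) = Sum.inr j' := by
  have key : ∀ i j, (∃ i', φ (Sum.inl i) = Sum.inl i') ∧ ∃ j', φ (Sum.inr j) = Sum.inr j' := by
    intro i j
    have hadj : (completeBipartiteGraph (Fin a) (Fin b)).Adj (φ (Sum.inl i)) (φ (Sum.inr j)) :=
      φ.map_adj_iff.2 (by simp)
    have hlt := hg i j
    rw [h, h] at hlt
    rw [completeBipartiteGraph_adj] at hadj
    rcases hi : φ (Sum.inl i) with u | u <;> rcases hj : φ (Sum.inr j) with v | v <;>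
      rw [hi, hj] at hadj hlt
    · simp at hadj
    · exact ⟨⟨u, rfl⟩, ⟨v, rfl⟩⟩
    · exact absurd (hf v u) hlt.not_gt
    · simp at hadj
  exact ⟨fun i ↦ (key i ⟨0, Nat.pos_of_ne_zero hb⟩).1,
    fun j ↦ (key ⟨0, Nat.pos_of_ne_zero ha⟩ j).2⟩

theorem exists_perm_of_image_eq {α β : Type*} [Fintype α] [DecidableEq β] {f g : α → β}
    (hg : Function.Injective g) (h : Finset.univ.image f = Finset.univ.image g) :
    ∃ σ : Equiv.Perm α, ∀ i, g i = f (σ i) := by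
  have : ∀ i, ∃ i', f i' = g i := fun i ↦ by
    have : g i ∈ Finset.univ.image f := h ▸ Finset.mem_image_of_mem g (Finset.mem_univ i)
    simpa using this
  choose σ hσ using this
  have hinj : Function.Injective σ := fun i i' e ↦ hg (by rw [← hσ, e, hσ])
  exact ⟨Equiv.ofBijective σ (Finite.injective_iff_bijective.1 hinj), fun i ↦ (hσ i).symm⟩

/-- An automorphism relating two labelings respects the parts, so it preserves both label sets.
Conversely, equal label sets differ by a permutation of each part, and any two such permutations
together form an automorphism. -/
theorem alphaGracefulSetoid_iff (ha : a ≠ 0) (hb : b ≠ 0)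
    (f g : {f : Fin a ⊕ Fin b → ℕ // IsAlphaGraceful (completeBipartiteGraph (Fin a) (Fin b))
      (Set.range Sum.inl) (Set.range Sum.inr) f}) :
    alphaGracefulSetoid _ _ _ f g ↔ labelSets f.1 = labelSets g.1 := by
  obtain ⟨f, hf⟩ := f
  obtain ⟨g, hg⟩ := g
  have hf' := labelSets_mem_differencePairs ha hb hf
  have hg' := labelSets_mem_differencePairs ha hb hg
  obtain ⟨-, hf2, hf3⟩ := isAlphaGraceful_completeBipartiteGraph_iff.1 hf
  obtain ⟨-, hg2, hg3⟩ := isAlphaGraceful_completeBipartiteGraph_iff.1 hg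
  obtain ⟨hgl, hgr⟩ := injective_of_bijOn_sub ha hb hg3
  constructor
  · rintro ⟨φ, h⟩
    obtain ⟨hl, hr⟩ := exists_apply_eq_of_isAlphaGraceful hf2 hg2 ha hb φ h
    refine (Prod.ext (Finset.eq_of_subset_of_card_le ?_ ?_)
      (Finset.eq_of_subset_of_card_le ?_ ?_)).symm
    · intro x hx
      obtain ⟨i, -, rfl⟩ := Finset.mem_image.1 hx
      obtain ⟨i', e⟩ := hl i
      exact Finset.mem_image.2 ⟨i', Finset.mem_univ _, ((congrArg f e).symm.trans (h _).symm)⟩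
    · rw [hf'.2.2.1, hg'.2.2.1]
    · intro x hx
      obtain ⟨i, -, rfl⟩ := Finset.mem_image.1 hx
      obtain ⟨i', e⟩ := hr i
      exact Finset.mem_image.2 ⟨i', Finset.mem_univ _, ((congrArg f e).symm.trans (h _).symm)⟩
    · rw [hf'.2.2.2.1, hg'.2.2.2.1]
  · intro h
    obtain ⟨σ, hσ⟩ := exists_perm_of_image_eq hgl (congrArg Prod.fst h)
    obtain ⟨τ, hτ⟩ := exists_perm_of_image_eq hgr (congrArg Prod.snd h)
    refine ⟨⟨Equiv.sumCongr σ τ, ?_⟩, ?_⟩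
    · rintro (i | i) (j | j) <;> simp
    · rintro (i | j)
      · exact hσ i
      · exact hτ j

/-- Essentially distinct α-graceful labelings of a complete bipartite graph correspond to pairs of
sets of labels. -/
theorem numAlphaGraceful_eq_ncard_differencePairs (ha : a ≠ 0) (hb : b ≠ 0) :
    numAlphaGraceful a b = (differencePairs a b).ncard := by
  rw [numAlphaGraceful, ← Nat.card_coe_set_eq]
  refine Nat.card_congr (Equiv.ofBijective (Quotient.lift
    (fun f ↦ (⟨labelSets f.1, labelSets_mem_differencePairs ha hb f.2⟩ : differencePairs a b))
    fun f g h ↦ Subtype.ext ((alphaGracefulSetoid_iff ha hb f g).1 h)) ⟨?_, ?_⟩)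
  · intro x y
    induction x using Quotient.ind with
    | _ f =>
    induction y using Quotient.ind with
    | _ g =>
    intro h
    exact Quotient.sound ((alphaGracefulSetoid_iff ha hb f g).2 (congrArg Subtype.val h))
  · rintro ⟨S, hS⟩
    obtain ⟨f, hf, rfl⟩ := exists_labelSets_eq hS
    exact ⟨Quotient.mk _ ⟨f, hf⟩, rfl⟩

/-! ### From differences to sums: difference pairs and tilings -/

/-- The image of a finite set of natural numbers under `x ↦ max A - x`. -/
def reflectMax (A : Finset ℕ) : Finset ℕ := A.image fun x ↦ A.sup id - x

theorem le_sup_id {A : Finset ℕ} {x : ℕ} (hx : x ∈ A) : x ≤ A.sup id := Finset.le_sup (f := id) hx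

theorem sup_id_mem {A : Finset ℕ} {x : ℕ} (hx : x ∈ A) : A.sup id ∈ A := by
  obtain ⟨y, hy, e⟩ := Finset.exists_mem_eq_sup A ⟨x, hx⟩ id
  rwa [e]

theorem card_reflectMax (A : Finset ℕ) : (reflectMax A).card = A.card := by
  refine Finset.card_image_of_injOn fun x hx y hy e ↦ ?_
  have := le_sup_id hx
  have := le_sup_id hy
  omega

theorem mem_reflectMax {A : Finset ℕ} {x : ℕ} :
    x ∈ reflectMax A ↔ x ≤ A.sup id ∧ A.sup id - x ∈ A := by
  simp only [reflectMax, Finset.mem_image]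
  constructor
  · rintro ⟨y, hy, rfl⟩
    have := le_sup_id hy
    refine ⟨by omega, by rwa [Nat.sub_sub_self this]⟩
  · rintro ⟨hx, h⟩
    exact ⟨_, h, by omega⟩

theorem sup_reflectMax {A : Finset ℕ} (h : 0 ∈ A) : (reflectMax A).sup id = A.sup id := by
  refine le_antisymm (Finset.sup_le fun x hx ↦ (mem_reflectMax.1 hx).1) ?_
  exact le_sup_id (mem_reflectMax.2 ⟨le_rfl, by simpa using h⟩)

theorem reflectMax_reflectMax {A : Finset ℕ} (h : 0 ∈ A) : reflectMax (reflectMax A) = A := by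
  ext x
  rw [mem_reflectMax, mem_reflectMax, sup_reflectMax h]
  constructor
  · rintro ⟨h1, -, h2⟩
    rwa [Nat.sub_sub_self h1] at h2
  · intro hx
    have := le_sup_id hx
    exact ⟨this, by omega, by rwa [Nat.sub_sub_self this]⟩

/-- With `M = max A`, the map `(A, B) ↦ (M - A, B + M + 1)` sends the sum `x + y` to the difference
`(y + M + 1) - (M - x) = x + y + 1`, so sums filling `{0, …, ab - 1}` become differences filling
`{1, …, ab}`. -/
theorem ncard_differencePairs (ha : a ≠ 0) (hb : b ≠ 0) :
    (differencePairs a b).ncard = (intervalTilings a b).card := by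
  have hN : 0 < a * b := by positivity
  rw [← Set.ncard_coe_finset]
  symm
  refine Set.ncard_congr
    (fun S _ ↦ (reflectMax S.1, S.2.image fun y ↦ y + (S.1.sup id + 1))) ?_ ?_ ?_
  · rintro ⟨A, B⟩ h
    obtain ⟨hA, hB, h⟩ := (mem_intervalTilings ha hb).1 (Finset.mem_coe.1 h)
    simp only at hA hB h ⊢
    have h0 := h.zero_mem hN
    have hM := sup_id_mem h0
    have hMN := h.lt_of_mem hN hM
    refine ⟨fun x hx ↦ ?_, fun y hy ↦ ?_, ?_, ?_, ?_⟩
    · have := (mem_reflectMax.1 hx).1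
      exact Finset.mem_Icc.2 ⟨Nat.zero_le _, by omega⟩
    · obtain ⟨y, hyB, rfl⟩ := Finset.mem_image.1 hy
      have := h.add_lt _ hM y hyB
      exact Finset.mem_Icc.2 ⟨Nat.zero_le _, by omega⟩
    · rw [card_reflectMax, hA]
    · rw [Finset.card_image_of_injective _ (add_left_injective _), hB]
    · ext z
      rw [Set.mem_ofPred_eq, ← Nat.cast_mul, Set.mem_Icc]
      constructor
      · rintro ⟨x, hx, y, hy, rfl⟩
        obtain ⟨y, hyB, rfl⟩ := Finset.mem_image.1 hy
        obtain ⟨hx1, hx2⟩ := mem_reflectMax.1 hx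
        have := h.add_lt _ hx2 y hyB
        omega
      · rintro ⟨hz1, hz2⟩
        obtain ⟨x, hx, y, hy, e⟩ := h.exists_add (z - 1).toNat (by omega)
        have := le_sup_id hx
        exact ⟨A.sup id - x, mem_reflectMax.2 ⟨by omega, by rwa [Nat.sub_sub_self this]⟩,
          _, Finset.mem_image_of_mem _ hy, by omega⟩
  · rintro ⟨A, B⟩ ⟨A', B'⟩ h h' e
    have h0 := ((mem_intervalTilings ha hb).1 (Finset.mem_coe.1 h)).2.2.zero_mem hN
    have h0' := ((mem_intervalTilings ha hb).1 (Finset.mem_coe.1 h')).2.2.zero_mem hN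
    simp only [Prod.mk.injEq] at e h0 h0'
    have hA : A = A' := by
      rw [← reflectMax_reflectMax h0, e.1, reflectMax_reflectMax h0']
    subst hA
    rw [Finset.image_injective (add_left_injective (A.sup id + 1)) e.2]
  · rintro ⟨S, T⟩ hS
    have hlt : ∀ x ∈ S, ∀ y ∈ T, x < y ∧ y - x ≤ a * b := fun x hx y hy ↦
      lt_of_mem_differencePairs hS hx hy
    have hex : ∀ z, 1 ≤ z → z ≤ a * b → ∃ x ∈ S, ∃ y ∈ T, y = x + z := fun z hz hz' ↦
      exists_sub_eq_of_mem_differencePairs hS hz hz'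
    have hinj := (bijOn_sub_of_mem_differencePairs hS).injOn
    -- Within `{0, …, ab}` the difference `ab` occurs only as `ab - 0`. Knowing `0 ∈ S` makes the
    -- reflection of `S` an involution.
    have h0 : 0 ∈ S := by
      obtain ⟨x, hx, y, hy, e⟩ := hex (a * b) hN le_rfl
      have := (Finset.mem_Icc.1 (hS.2.1 hy)).2
      rwa [show 0 = x by omega]
    have hM := sup_id_mem h0
    -- Every element of `T` exceeds `max S`, so the truncated subtraction is exact.
    have hT : (T.image fun y ↦ y - (S.sup id + 1)).image (fun y ↦ y + (S.sup id + 1)) = T := by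
      rw [Finset.image_image]
      conv_rhs => rw [← Finset.image_id (s := T)]
      refine Finset.image_congr fun y hy ↦ ?_
      have := (hlt _ hM y hy).1
      simp only [Function.comp_apply, id_eq]
      omega
    refine ⟨(reflectMax S, T.image fun y ↦ y - (S.sup id + 1)), ?_, ?_⟩
    · refine Finset.mem_coe.2 ((mem_intervalTilings ha hb).2 ⟨?_, ?_, ?_, ?_, ?_⟩)
      · rw [card_reflectMax, hS.2.2.1]
      · refine (Finset.card_image_of_injOn fun y hy y' hy' e ↦ ?_).trans hS.2.2.2.1
        have := (hlt _ hM y hy).1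
        have := (hlt _ hM y' hy').1
        omega
      · intro x hx y hy
        obtain ⟨y, hyT, rfl⟩ := Finset.mem_image.1 hy
        obtain ⟨hx1, hx2⟩ := mem_reflectMax.1 hx
        have := hlt _ hx2 y hyT
        have := (hlt _ hM y hyT).1
        omega
      · intro z hz
        obtain ⟨x, hx, y, hy, e⟩ := hex (z + 1) (by omega) hz
        have := le_sup_id hx
        have := (hlt _ hM y hy).1
        exact ⟨S.sup id - x, mem_reflectMax.2 ⟨by omega, by rwa [Nat.sub_sub_self ‹_›]⟩,
          _, Finset.mem_image_of_mem _ hy, by omega⟩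
      · intro x hx x' hx' y hy y' hy' e
        obtain ⟨y, hyT, rfl⟩ := Finset.mem_image.1 hy
        obtain ⟨y', hyT', rfl⟩ := Finset.mem_image.1 hy'
        obtain ⟨hx1, hx2⟩ := mem_reflectMax.1 hx
        obtain ⟨hx1', hx2'⟩ := mem_reflectMax.1 hx'
        have := (hlt _ hM y hyT).1
        have := (hlt _ hM y' hyT').1
        have := hinj (Finset.mem_coe.2 (Finset.mk_mem_product hx2 hyT))
          (Finset.mem_coe.2 (Finset.mk_mem_product hx2' hyT')) (by simp only; omega)
        simp only [Prod.mk.injEq] at this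
        omega
    · simp only [reflectMax_reflectMax h0, sup_reflectMax h0, hT]

end Graceful

/-! ### Conclusion -/

open ArithmeticFunction in
theorem numAlphaGraceful_prime_pow_mul {n p₁ p₂ q₁ q₂ a b : ℕ}
    (hp₁ : p₁.Prime) (hp₂ : p₂.Prime) (hp : p₁ ≠ p₂)
    (hq₁ : q₁.Prime) (hq₂ : q₂.Prime) (hq : q₁ ≠ q₂)
    (ha : a = p₁ ^ n * p₂ ^ n) (hb : b = q₁ ^ n * q₂ ^ n) :
    (numAlphaGraceful a b : ℤ) =
      ∑ i ∈ Finset.range (2 * n + 1), (-1 : ℤ) ^ (n + i) * ((2 * n).choose i : ℤ) ^ 4 := by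
  have ha0 : a ≠ 0 := by
    rw [ha]; exact mul_ne_zero (pow_ne_zero _ hp₁.ne_zero) (pow_ne_zero _ hp₂.ne_zero)
  have hb0 : b ≠ 0 := by
    rw [hb]; exact mul_ne_zero (pow_ne_zero _ hq₁.ne_zero) (pow_ne_zero _ hq₂.ne_zero)
  rw [numAlphaGraceful_eq_ncard_differencePairs ha0 hb0, ncard_differencePairs ha0 hb0,
    -- Any `K` with `a ≤ K`, `b ≤ K` and `2 * n < K` would do.
    card_intervalTilings ha0 hb0 (K := a + b + 2 * n + 1) (by omega) (by omega),
    sum_pointedOrderedFactorizations_mul hp₁ hp₂ hp hq₁ hq₂ hq ha hb (by omega)]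

theorem theorem1 (n p₁ p₂ q₁ q₂ a b : ℕ)
    (hp₁ : p₁.Prime) (hp₂ : p₂.Prime) (hp : p₁ ≠ p₂)
    (hq₁ : q₁.Prime) (hq₂ : q₂.Prime) (hq : q₁ ≠ q₂)
    (ha : a = p₁ ^ n * p₂ ^ n) (hb : b = q₁ ^ n * q₂ ^ n) :
    (numAlphaGraceful a b : ℤ) =
        ∑ i ∈ Finset.range (2 * n + 1), (-1 : ℤ) ^ (n + i) * ((2 * n).choose i : ℤ) ^ 4 ∧
      (numAlphaGraceful a b : ℤ) =
        (-1 : ℤ) ^ n *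
          ∑ i ∈ Finset.range (2 * n + 1), (-1 : ℤ) ^ i * ((2 * n).choose i : ℤ) ^ 4 ∧
      (differencePairs a b).ncard = numAlphaGraceful a b := by
  have h := numAlphaGraceful_prime_pow_mul hp₁ hp₂ hp hq₁ hq₂ hq ha hb
  have ha0 : a ≠ 0 := by
    rw [ha]; exact mul_ne_zero (pow_ne_zero _ hp₁.ne_zero) (pow_ne_zero _ hp₂.ne_zero)
  have hb0 : b ≠ 0 := by
    rw [hb]; exact mul_ne_zero (pow_ne_zero _ hq₁.ne_zero) (pow_ne_zero _ hq₂.ne_zero)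
  refine ⟨h, ?_, (numAlphaGraceful_eq_ncard_differencePairs ha0 hb0).symm⟩
  rw [h, Finset.mul_sum]
  exact Finset.sum_congr rfl fun i _ ↦ by rw [pow_add, mul_assoc]
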